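/- **Theorem.** Let $\Bbbk$ be a field, $n \ge 0$, and let $I \subseteq \Bbbk[\mathbf x] = \Bbbk[x_1,\dots,x_n]$ be a monomial ideal. For $\mathbf b \in \mathbb N^n$ let $K^{\mathbf b}I = \{\tau \subseteq \{1,\dots,n\} : \mathbf x^{\mathbf b-\tau} \in I\}$ be its (upper) Koszul simplicial complex, where $\tau$ is identified with its indicator vector and $\mathbf b-\tau$ is required to lie in $\mathbb N^n$. Let $\partial^{\mathbf b}_i : \widetilde C_i K^{\mathbf b}I \to \widetilde C_{i-1}K^{\mathbf b}I$ be the differentials of its reduced chain complex over $\Bbbk$, in which the coefficient of $\tau\smallsetminus k$ in the boundary of a face $\tau \ni k$ is the usual sign $(-1)^{\tau\smallsetminus k\subset\tau} = (-1)^{\#\{l\in\tau\,:\,l<k\}}$; let $\widetilde Z_i$ denote cycles and $\widetilde H_i$ reduced homology. For every $\mathbf b \in \mathbb N^n$ let linear maps $\partial^{\mathbf b+}_i : \widetilde C_{i-1}K^{\mathbf b}I \to \widetilde C_i K^{\mathbf b}I$ (for all $i$) be given that form a differential, $\partial^{\mathbf b+}\partial^{\mathbf b+} = 0$, and satisfy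 $$\partial^{\mathbf b}\partial^{\mathbf b+}\partial^{\mathbf b} = \partial^{\mathbf b}, \qquad \partial^{\mathbf b+}\partial^{\mathbf b}\partial^{\mathbf b+} = \partial^{\mathbf b+}.$$ For $\mathbf a,\mathbf b \in \mathbb N^n$ let $\Lambda(\mathbf a,\mathbf b)$ be the set of saturated decreasing lattice paths $\mathbf b = \mathbf b_0, \mathbf b_1,\dots,\mathbf b_\ell = \mathbf a$ with $\ell \ge 1$ steps, where each $\lambda_j = \mathbf b_{j-1}-\mathbf b_j$ is a standard basis vector (also identified with its index in $\{1,\dots,n\}$). Let $d_1^{\lambda_j}$ take a face $\tau$ of $K^{\mathbf b_{j-1}}I$ to $0$ if $\lambda_j \notin \tau$ and to $(-1)^{\tau\smallsetminus\lambda_j\subset\tau}\,\tau\smallsetminus\lambda_j$, a face of $K^{\mathbf b_j}I$, if $\lambda_j\in\tau$. For $i \ge 0$ define, on $\widetilde C_i K^{\mathbf b}I$, $$D^{\mathbf a\mathbf b} = \sum_{\lambda\in\Lambda(\mathbf a,\mathbf b)} (1-\partial^{\mathbf a+}_i\partial^{\mathbf a}_i)\, d_1^{\lambda_\ell}\, \bigl(\partial_i^{\mathbf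 b_{\ell-1}+} d_1^{\lambda_{\ell-1}}\bigr)\cdots\bigl(\partial_i^{\mathbf b_1+} d_1^{\lambda_1}\bigr)\,(1-\partial^{\mathbf b}_{i+1}\partial^{\mathbf b+}_{i+1}).$$ Then $D^{\mathbf a\mathbf b}$ maps $\widetilde Z_iK^{\mathbf b}I$ to $\widetilde Z_{i-1}K^{\mathbf a}I$ and vanishes on boundaries, so that it induces a map $\widetilde H_{i-1}K^{\mathbf a}I \leftarrow \widetilde H_iK^{\mathbf b}I$. The free $\mathbb N^n$-graded modules $$F_i = \bigoplus_{\mathbf b\in\mathbb N^n} \widetilde H_{i-1}K^{\mathbf b}I \otimes_{\Bbbk} \Bbbk[\mathbf x](-\mathbf b) \qquad (i \ge 0),$$ with the $\Bbbk[\mathbf x]$-linear differentials $F_{i+1} \to F_i$ whose component $\widetilde H_{i-1}K^{\mathbf a}I\otimes\Bbbk[\mathbf x](-\mathbf a) \leftarrow \widetilde H_iK^{\mathbf b}I\otimes\Bbbk[\mathbf x](-\mathbf b)$ is induced in degree $\mathbf b$ by $D^{\mathbf a\mathbf b}$, that is, sends $h \otimes p$ to $D^{\mathbf a\mathbf b}h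 \otimes \mathbf x^{\mathbf b-\mathbf a}p$ (and is $0$ unless $\mathbf a \prec \mathbf b$), form an $\mathbb N^n$-graded minimal free resolution of $I$: the $F_i$ are finitely generated and free, the differentials preserve $\mathbb N^n$-degree, there is a degree-preserving surjection $F_0 \to I$ with which the complex $\cdots\to F_1\to F_0\to I\to 0$ is exact, and the image of $F_{i+1}$ in $F_i$ lies in $\langle x_1,\dots,x_n\rangle F_i$ for every $i \ge 0$. -/

import Mathlib

open scoped TensorProduct DirectSum

noncomputable section

namespace KoszulSplit

variable {k : Type*} [Field k] {n : ℕ}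

/-- A monomial ideal: an ideal generated by a set of monomials. -/
def IsMonomialIdeal (I : Ideal (MvPolynomial (Fin n) k)) : Prop :=
  ∃ S : Set (Fin n →₀ ℕ), I = Ideal.span ((fun u => MvPolynomial.monomial u (1 : k)) '' S)

/-- The squarefree exponent vector in `{0,1}^n` of a subset `τ` of `{1,…,n}`. -/
def indicator (τ : Finset (Fin n)) : Fin n →₀ ℕ := ∑ i ∈ τ, Finsupp.single i 1

/-- The faces of the upper Koszul simplicial complex `K^b I`: the subsets `τ` with
`x^(b-τ) ∈ I`; a vector `b - τ` with a negative entry is not an exponent of a monomial of `I`. -/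
def koszulFaces (I : Ideal (MvPolynomial (Fin n) k)) (b : Fin n →₀ ℕ) : Set (Finset (Fin n)) :=
  {τ | indicator τ ≤ b ∧ MvPolynomial.monomial (b - indicator τ) (1 : k) ∈ I}

/-- The map `τ ↦ (-1)^(τ∖i ⊂ τ) (τ∖i)` if `i ∈ τ`, and `τ ↦ 0` if `i ∉ τ`, on the vector space
with basis all subsets of `{1,…,n}`. The sign is the usual one: the parity of the position of `i`
in the increasing list of elements of `τ`. -/
def removeVertex (i : Fin n) : (Finset (Fin n) →₀ k) →ₗ[k] (Finset (Fin n) →₀ k) :=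
  Finsupp.lsum k fun τ => LinearMap.toSpanSingleton k _
    (if i ∈ τ then Finsupp.single (τ.erase i) ((-1 : k) ^ (τ.filter (· < i)).card) else 0)

/-- The reduced simplicial boundary operator on the span of all subsets of `{1,…,n}`. -/
def boundary : (Finset (Fin n) →₀ k) →ₗ[k] (Finset (Fin n) →₀ k) := ∑ i, removeVertex i

/-- The reduced chains of `K^b I` of all dimensions together: the span of the faces. -/
def chains (I : Ideal (MvPolynomial (Fin n) k)) (b : Fin n →₀ ℕ) : Type _ :=
  Finsupp.supported k k (koszulFaces I b)

instance (I : Ideal (MvPolynomial (Fin n) k)) (b : Fin n →₀ ℕ) : AddCommGroup (chains I b) :=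
  inferInstanceAs (AddCommGroup (Finsupp.supported k k (koszulFaces I b)))

instance (I : Ideal (MvPolynomial (Fin n) k)) (b : Fin n →₀ ℕ) : Module k (chains I b) :=
  inferInstanceAs (Module k (Finsupp.supported k k (koszulFaces I b)))

/-- The inclusion of the chains of `K^b I` into the span of all subsets of `{1,…,n}`. -/
def inclusion (I : Ideal (MvPolynomial (Fin n) k)) (b : Fin n →₀ ℕ) :
    chains I b →ₗ[k] (Finset (Fin n) →₀ k) :=
  (Finsupp.supported k k (koszulFaces I b)).subtype

/-- The reduced chains of `K^b I` spanned by the faces with `j` vertices, that is, of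
dimension `j - 1`; the case `j = 0` is the span of the empty face. -/
def chainsOfCard (I : Ideal (MvPolynomial (Fin n) k)) (b : Fin n →₀ ℕ) (j : ℕ) :
    Submodule k (chains I b) :=
  (Finsupp.supported k k {τ : Finset (Fin n) | τ.card = j}).comap (inclusion I b)

theorem removeVertex_single (i : Fin n) (τ : Finset (Fin n)) (r : k) :
    removeVertex i (Finsupp.single τ r) =
      if i ∈ τ then Finsupp.single (τ.erase i) (r * (-1 : k) ^ (τ.filter (· < i)).card) else 0 := by
  unfold removeVertex
  rw [Finsupp.lsum_single, LinearMap.toSpanSingleton_apply]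
  split_ifs <;> simp

theorem removeVertex_mem_supported {s t : Set (Finset (Fin n))} {i : Fin n}
    (h : ∀ τ ∈ s, i ∈ τ → τ.erase i ∈ t) {c : Finset (Fin n) →₀ k}
    (hc : c ∈ Finsupp.supported k k s) : removeVertex i c ∈ Finsupp.supported k k t := by
  rw [Finsupp.supported_eq_span_single] at hc
  induction hc using Submodule.span_induction with
  | mem x hx =>
    obtain ⟨τ, hτ, rfl⟩ := hx
    dsimp only
    rw [removeVertex_single]
    split_ifs with hi
    · exact Finsupp.single_mem_supported k _ (h τ hτ hi)
    · exact zero_mem _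
  | zero => simp
  | add x y _ _ hx hy => rw [map_add]; exact add_mem hx hy
  | smul r x _ hx => rw [map_smul]; exact Submodule.smul_mem _ _ hx

theorem indicator_erase {i : Fin n} {τ : Finset (Fin n)} (hi : i ∈ τ) :
    indicator τ = indicator (τ.erase i) + Finsupp.single i 1 := by
  unfold indicator
  rw [add_comm, Finset.add_sum_erase τ (fun i => Finsupp.single i 1) hi]

theorem erase_mem_koszulFaces (I : Ideal (MvPolynomial (Fin n) k)) (b : Fin n →₀ ℕ) {i : Fin n}
    {τ : Finset (Fin n)} (hτ : τ ∈ koszulFaces I b) (hi : i ∈ τ) :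
    τ.erase i ∈ koszulFaces I b := by
  obtain ⟨h1, h2⟩ := hτ
  rw [indicator_erase hi] at h1 h2
  have h3 : indicator (τ.erase i) ≤ b := le_trans le_self_add h1
  refine ⟨h3, ?_⟩
  have h4 : b - indicator (τ.erase i) =
      Finsupp.single i 1 + (b - (indicator (τ.erase i) + Finsupp.single i 1)) := by
    rw [← tsub_tsub, add_tsub_cancel_of_le]
    rw [le_tsub_iff_left h3]
    exact h1
  rw [h4, ← one_mul (1 : k), ← MvPolynomial.monomial_mul]
  exact I.mul_mem_left _ (by simpa using h2)

theorem erase_mem_koszulFaces_step (I : Ideal (MvPolynomial (Fin n) k)) (c : Fin n →₀ ℕ)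
    {i : Fin n} {τ : Finset (Fin n)} (hτ : τ ∈ koszulFaces I (c + Finsupp.single i 1))
    (hi : i ∈ τ) : τ.erase i ∈ koszulFaces I c := by
  obtain ⟨h1, h2⟩ := hτ
  rw [indicator_erase hi] at h1 h2
  refine ⟨le_of_add_le_add_right h1, ?_⟩
  rwa [add_tsub_add_eq_tsub_right] at h2

/-- The differential `∂^b` of the reduced chain complex of `K^b I`. -/
def koszulBoundary (I : Ideal (MvPolynomial (Fin n) k)) (b : Fin n →₀ ℕ) :
    chains I b →ₗ[k] chains I b :=
  boundary.restrict fun c hc => by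
    rw [boundary, LinearMap.sum_apply]
    exact sum_mem fun i _ =>
      removeVertex_mem_supported (fun τ hτ hi => erase_mem_koszulFaces I b hτ hi) hc

/-- The map `d₁^i` from the chains of `K^(c+e_i) I` to the chains of `K^c I`. -/
def stepDown (I : Ideal (MvPolynomial (Fin n) k)) (c : Fin n →₀ ℕ) (i : Fin n) :
    chains I (c + Finsupp.single i 1) →ₗ[k] chains I c :=
  (removeVertex i).restrict fun _ hx =>
    removeVertex_mem_supported (fun _ hτ hi => erase_mem_koszulFaces_step I c hτ hi) hx

theorem removeVertex_card {i : Fin n} {j : ℕ} {x : Finset (Fin n) →₀ k}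
    (hx : x ∈ Finsupp.supported k k {τ : Finset (Fin n) | τ.card = j + 1}) :
    removeVertex i x ∈ Finsupp.supported k k {τ : Finset (Fin n) | τ.card = j} :=
  removeVertex_mem_supported (fun τ hτ hi => by
    rw [Set.mem_ofPred_eq] at hτ ⊢
    rw [Finset.card_erase_of_mem hi, hτ]; rfl) hx

theorem koszulBoundary_card (I : Ideal (MvPolynomial (Fin n) k)) (b : Fin n →₀ ℕ) {j : ℕ}
    {x : chains I b} (hx : x ∈ chainsOfCard I b (j + 1)) :
    koszulBoundary I b x ∈ chainsOfCard I b j := by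
  change boundary (inclusion I b x) ∈ Finsupp.supported k k _
  rw [boundary, LinearMap.sum_apply]
  exact sum_mem fun i _ => removeVertex_card hx

theorem stepDown_card (I : Ideal (MvPolynomial (Fin n) k)) (c : Fin n →₀ ℕ) (i : Fin n) {j : ℕ}
    {x : chains I (c + Finsupp.single i 1)} (hx : x ∈ chainsOfCard I _ (j + 1)) :
    stepDown I c i x ∈ chainsOfCard I c j :=
  removeVertex_card hx

/-- The reduced cycles of `K^b I` of dimension `j - 1`. -/
def cycles (I : Ideal (MvPolynomial (Fin n) k)) (b : Fin n →₀ ℕ) (j : ℕ) :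
    Submodule k (chains I b) :=
  chainsOfCard I b j ⊓ LinearMap.ker (koszulBoundary I b)

/-- The reduced boundaries of `K^b I` of dimension `j - 1`. -/
def boundaries (I : Ideal (MvPolynomial (Fin n) k)) (b : Fin n →₀ ℕ) (j : ℕ) :
    Submodule k (chains I b) :=
  (chainsOfCard I b (j + 1)).map (koszulBoundary I b)

/-- The reduced homology `H̃_(j-1)(K^b I; k)`, as cycles modulo boundaries. -/
abbrev homology (I : Ideal (MvPolynomial (Fin n) k)) (b : Fin n →₀ ℕ) (j : ℕ) : Type _ :=
  cycles I b j ⧸ (boundaries I b j).comap (cycles I b j).subtype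

/-- A splitting `∂⁺` of the differential `∂` of the reduced chain complex of `K^b I`: a linear map
raising dimension by one, that is itself a differential, with `∂∂⁺∂ = ∂` and `∂⁺∂∂⁺ = ∂⁺`. -/
structure Splitting (I : Ideal (MvPolynomial (Fin n) k)) (b : Fin n →₀ ℕ) where
  up : chains I b →ₗ[k] chains I b
  up_mem : ∀ (j : ℕ), ∀ x ∈ chainsOfCard I b j, up x ∈ chainsOfCard I b (j + 1)
  up_up : up ∘ₗ up = 0
  del_up_del : koszulBoundary I b ∘ₗ up ∘ₗ koszulBoundary I b = koszulBoundary I b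
  up_del_up : up ∘ₗ koszulBoundary I b ∘ₗ up = up

/-- `LatticePath a b` is the type of saturated decreasing lattice paths in `ℕ^n`, with at least
one step, from `b` to `a`: `step i` is the one-step path `a + e_i, a`, and `cons i p` is the path
that first steps from `c + e_i` to `c` and then follows `p` from `c` to `a`. -/
inductive LatticePath (a : Fin n →₀ ℕ) : (Fin n →₀ ℕ) → Type
  | step (i : Fin n) : LatticePath a (a + Finsupp.single i 1)
  | cons {c : Fin n →₀ ℕ} (i : Fin n) (p : LatticePath a c) :
      LatticePath a (c + Finsupp.single i 1)

namespace LatticePath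

/-- The directions of the steps of a path, starting at the upper end. -/
def directions {a : Fin n →₀ ℕ} : {b : Fin n →₀ ℕ} → LatticePath a b → List (Fin n)
  | _, step i => [i]
  | _, cons i p => i :: p.directions

theorem sum_directions {a b : Fin n →₀ ℕ} (p : LatticePath a b) :
    b = a + (p.directions.map fun i => Finsupp.single i 1).sum := by
  induction p with
  | step i => simp [directions]
  | cons i p ih =>
    rw [directions, List.map_cons, List.sum_cons, add_left_comm, ← ih, add_comm]

theorem directions_ne_nil {a b : Fin n →₀ ℕ} (p : LatticePath a b) : p.directions ≠ [] := by
  cases p <;> simp [directions]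

theorem heq_of_directions {a b : Fin n →₀ ℕ} (p : LatticePath a b) :
    ∀ {b' : Fin n →₀ ℕ} (q : LatticePath a b'), b = b' → p.directions = q.directions → p ≍ q := by
  induction p with
  | step i =>
    intro b' q hb h
    cases q with
    | step j =>
      simp only [directions, List.cons.injEq, and_true] at h
      subst h
      rfl
    | cons j q =>
      simp only [directions, List.cons.injEq] at h
      exact absurd h.2.symm q.directions_ne_nil
  | cons i p ih =>
    intro b' q hb h
    cases q with
    | step j =>
      simp only [directions, List.cons.injEq] at h
      exact absurd h.2 p.directions_ne_nil
    | cons j q =>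
      simp only [directions, List.cons.injEq] at h
      obtain ⟨rfl, h⟩ := h
      have hc := add_right_cancel hb
      subst hc
      rw [eq_of_heq (ih q rfl h)]

theorem length_directions {a b : Fin n →₀ ℕ} (p : LatticePath a b) :
    p.directions.length ≤ b.degree := by
  induction p with
  | step i => simp [directions]
  | cons i p ih => simpa [directions] using ih

instance (a b : Fin n →₀ ℕ) : Finite (LatticePath a b) := by
  have : Finite {l : List (Fin n) | l.length ≤ b.degree} :=
    (List.finite_length_le (Fin n) b.degree).to_subtype
  refine Finite.of_injective
    (fun p : LatticePath a b =>
      (⟨p.directions, p.length_directions⟩ : {l : List (Fin n) | l.length ≤ b.degree})) ?_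
  intro p q h
  exact eq_of_heq (heq_of_directions p q rfl (congrArg Subtype.val h))

instance (a b : Fin n →₀ ℕ) : Fintype (LatticePath a b) := Fintype.ofFinite _

/-- For the path `b = b₀, b₁, …, b_ℓ = a` with steps `λ₁, …, λ_ℓ`, the composite
`d₁^{λ_ℓ} ∂^{b_{ℓ-1}+} d₁^{λ_{ℓ-1}} ⋯ ∂^{b_1+} d₁^{λ_1}` from the chains of `K^b I` to the chains
of `K^a I`. -/
def transport {I : Ideal (MvPolynomial (Fin n) k)} (s : ∀ b, Splitting I b) {a : Fin n →₀ ℕ} :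
    {b : Fin n →₀ ℕ} → LatticePath a b → (chains I b →ₗ[k] chains I a)
  | _, step i => stepDown I a i
  | _, cons (c := c) i p => p.transport s ∘ₗ (s c).up ∘ₗ stepDown I c i

theorem transport_card {I : Ideal (MvPolynomial (Fin n) k)} (s : ∀ b, Splitting I b)
    {a b : Fin n →₀ ℕ} (p : LatticePath a b) {j : ℕ} {x : chains I b}
    (hx : x ∈ chainsOfCard I b (j + 1)) : p.transport s x ∈ chainsOfCard I a j := by
  induction p with
  | step i => exact stepDown_card I _ i hx
  | cons i p ih => exact ih ((s _).up_mem _ _ (stepDown_card I _ i hx))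

end LatticePath

/-- The chain-level map
`D = ∑_λ (1 - ∂^{a+} ∂^a) d₁^{λ_ℓ} (∏_j ∂^{b_j+} d₁^{λ_j}) (1 - ∂^b ∂^{b+})`,
summed over the saturated decreasing lattice paths `λ` from `b` to `a`. -/
def pathSum {I : Ideal (MvPolynomial (Fin n) k)} (s : ∀ b, Splitting I b) (a b : Fin n →₀ ℕ) :
    chains I b →ₗ[k] chains I a :=
  ∑ p : LatticePath a b,
    (LinearMap.id - (s a).up ∘ₗ koszulBoundary I a) ∘ₗ p.transport s ∘ₗ
      (LinearMap.id - koszulBoundary I b ∘ₗ (s b).up)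

theorem pathSum_mem_cycles {I : Ideal (MvPolynomial (Fin n) k)} (s : ∀ b, Splitting I b)
    (a b : Fin n →₀ ℕ) (j : ℕ) (x : chains I b) (hx : x ∈ cycles I b (j + 1)) :
    pathSum s a b x ∈ cycles I a j := by
  rw [pathSum, LinearMap.sum_apply]
  refine sum_mem fun p _ => ?_
  have h1 : x - koszulBoundary I b ((s b).up x) ∈ chainsOfCard I b (j + 1) :=
    sub_mem hx.1 (koszulBoundary_card I b ((s b).up_mem _ _ hx.1))
  have h2 := p.transport_card s h1
  refine ⟨?_, ?_⟩
  · change p.transport s _ - (s a).up (koszulBoundary I a (p.transport s _)) ∈ chainsOfCard I a j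
    refine sub_mem h2 ?_
    cases j with
    | zero =>
      have h3 : koszulBoundary I a (p.transport s (x - koszulBoundary I b ((s b).up x))) = 0 := by
        apply Subtype.ext
        change boundary (inclusion I a
          (p.transport s (x - koszulBoundary I b ((s b).up x)))) = 0
        rw [boundary, LinearMap.sum_apply]
        refine Finset.sum_eq_zero fun i _ => ?_
        have h5 := removeVertex_mem_supported (i := i)
          (t := (∅ : Set (Finset (Fin n)))) (fun τ hτ hi => by
            rw [Set.mem_ofPred_eq, Finset.card_eq_zero] at hτ
            simp [hτ] at hi) h2
        simpa using h5
      change (s a).up (koszulBoundary I a (p.transport s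
        (x - koszulBoundary I b ((s b).up x)))) ∈ chainsOfCard I a 0
      rw [h3, map_zero]
      exact zero_mem _
    | succ j => exact (s a).up_mem _ _ (koszulBoundary_card I a h2)
  · refine LinearMap.mem_ker.2 ?_
    rw [LinearMap.comp_apply, LinearMap.sub_apply, map_sub,
      LinearMap.id_apply, sub_eq_zero]
    exact (LinearMap.congr_fun (s a).del_up_del _).symm

theorem pathSum_boundary {I : Ideal (MvPolynomial (Fin n) k)} (s : ∀ b, Splitting I b)
    (a b : Fin n →₀ ℕ) (x : chains I b) : pathSum s a b (koszulBoundary I b x) = 0 := by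
  rw [pathSum, LinearMap.sum_apply]
  refine Finset.sum_eq_zero fun p _ => ?_
  have h : (LinearMap.id - koszulBoundary I b ∘ₗ (s b).up : chains I b →ₗ[k] chains I b)
      (koszulBoundary I b x) = 0 := by
    rw [LinearMap.sub_apply, LinearMap.id_apply, sub_eq_zero]
    exact (LinearMap.congr_fun (s b).del_up_del x).symm
  rw [LinearMap.comp_apply, LinearMap.comp_apply, h, map_zero, map_zero]

/-- The map `H̃_(j-1)(K^a I) ← H̃_j(K^b I)` that sends the class of a cycle `z` to the class
of the cycle `D z`. -/
def homologyMap {I : Ideal (MvPolynomial (Fin n) k)} (s : ∀ b, Splitting I b)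
    (a b : Fin n →₀ ℕ) (j : ℕ) : homology I b (j + 1) →ₗ[k] homology I a j :=
  Submodule.mapQ _ _ ((pathSum s a b).restrict (pathSum_mem_cycles s a b j)) fun z hz => by
    obtain ⟨x, -, hx⟩ := hz
    change pathSum s a b z.1 ∈ boundaries I a j
    have hx' : koszulBoundary I b x = z.1 := hx
    rw [← hx', pathSum_boundary]
    exact zero_mem _

/-- The free module `⨁_b H̃_(i-1)(K^b I) ⊗ k[x](-b)` in homological stage `i`. -/
abbrev stage (I : Ideal (MvPolynomial (Fin n) k)) (i : ℕ) : Type _ :=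
  ⨁ b : Fin n →₀ ℕ, MvPolynomial (Fin n) k ⊗[k] homology I b i

/-- The `ℕ^n`-degree `c` part of `⨁_b H̃_(i-1)(K^b I) ⊗ k[x](-b)`: the span of the elements
`x^u ⊗ h` in the summand of index `b` with `b + u = c`. -/
def gradedPiece (I : Ideal (MvPolynomial (Fin n) k)) (i : ℕ) (c : Fin n →₀ ℕ) :
    Submodule k (stage I i) :=
  Submodule.span k {y | ∃ (b u : Fin n →₀ ℕ) (h : homology I b i), b + u = c ∧
    y = DirectSum.lof (MvPolynomial (Fin n) k) (Fin n →₀ ℕ)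
      (fun b => MvPolynomial (Fin n) k ⊗[k] homology I b i) b
      (MvPolynomial.monomial u (1 : k) ⊗ₜ[k] h)}

/-- The map `H ⊗ k[x](-b) → H' ⊗ k[x](-a)` of `ℕ^n`-graded free modules induced by a linear map
`f : H → H'` in degree `b`: it sends `p ⊗ h` to `x^(b-a) p ⊗ f h`. -/
def inducedMap {H H' : Type*} [AddCommGroup H] [Module k H] [AddCommGroup H'] [Module k H']
    (a b : Fin n →₀ ℕ) (f : H →ₗ[k] H') :
    MvPolynomial (Fin n) k ⊗[k] H →ₗ[MvPolynomial (Fin n) k] MvPolynomial (Fin n) k ⊗[k] H' :=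
  MvPolynomial.monomial (b - a) (1 : k) • f.baseChange (MvPolynomial (Fin n) k)

/-- The complex `⋯ → F 1 → F 0` with differentials `D`, together with `ε : F 0 → M`, is a minimal
free resolution of `M`, where `m` is the maximal ideal relative to which minimality is meant. -/
structure IsMinimalFreeResolution {R : Type*} [CommRing R] (m : Ideal R) {M : Type*}
    [AddCommGroup M] [Module R M] (F : ℕ → Type*) [∀ i, AddCommGroup (F i)] [∀ i, Module R (F i)]
    (D : ∀ i, F (i + 1) →ₗ[R] F i) (ε : F 0 →ₗ[R] M) : Prop where
  free : ∀ i, Module.Free R (F i)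
  finite : ∀ i, Module.Finite R (F i)
  exact : ∀ i, Function.Exact (D (i + 1)) (D i)
  exact_augmentation : Function.Exact (D 0) ε
  surjective : Function.Surjective ε
  minimal : ∀ i, LinearMap.range (D i) ≤ m • (⊤ : Submodule R (F i))

end KoszulSplit

end

open scoped TensorProduct DirectSum

noncomputable section

namespace KoszulSplit


/-! Fix a degree `c` and keep the chains themselves instead of their homology. The degree `c` part
of `⨁ b, C(K^b I) ⊗ k[x](-b)` consists of families of chains indexed by `b ≤ c`. A face `τ` of `K^b
I` is the lattice cube from `b - τ` to `b`, and all its vertices are exponents of monomials in `I`.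
Let `p` be the sum of the differentials `∂^b` and `q` the sum of all `d₁^i`. Then `p` takes the
facets of a cube that contain the vertex `b` and `q` takes the opposite ones, so `p - q` is the
cubical boundary. As `I` is closed under raising exponents, the cubes below `c` can be pushed up,
one coordinate at a time, to the vertex `c`. Hence every cycle is a boundary, apart from the
augmentation in the lowest degree (`IsBoxChain.exists_latticeBoundary_eq`), and the large complex is
a resolution of `I`, usually not minimal.

Homological perturbation shrinks it. Let `h` be the family of splittings and `e = 1 - ph - hp` the
projection to harmonic chains, which represent homology uniquely. Since `q` lowers `b`, the product
`hq` is nilpotent on the box below `c`, and `N = ∑ (hq)^m` inverts `1 - hq`. On harmonic chains `(p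
- q)N = -N(eqNe)` (`IsPerturbation.diff_mul_inv_mul_proj`). So `eqNe` squares to zero, and
`IsPerturbation.exists_perturbed_eq` carries exactness from `p - q` over to it.

Expanding `qN` step by step gives the sum over lattice paths (`pathTransport_eq`), and the two outer
factors of `D` act on homology classes as `e` (`harmonicRep_homologyMap`). Thus `eqNe` is the
differential of the theorem, seen in degree `c` (`boxRep_degreeDiff`).

Minimality holds because a path has at least one step, so a nonzero component carries a nontrivial
monomial. Finiteness holds because `K^b I` is a cone as soon as some coordinate of `b` exceeds the
exponents of a finite set of generators. What remains is to split elements of the free modules into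
homogeneous parts. -/

/-- The map `τ ↦ (-1)^#{l ∈ τ | l < i} (τ ∪ i)` if `i ∉ τ`, and `τ ↦ 0` if `i ∈ τ`. -/
def addVertex {k : Type*} [Field k] {n : ℕ} (i : Fin n) :
    (Finset (Fin n) →₀ k) →ₗ[k] (Finset (Fin n) →₀ k) :=
  Finsupp.lsum k fun τ => LinearMap.toSpanSingleton k _
    (if i ∈ τ then 0 else Finsupp.single (insert i τ) ((-1 : k) ^ (τ.filter (· < i)).card))

/-! ### Removing and adding a vertex: exterior algebra relations. -/

section Vertex

variable {k : Type*} [Field k] {n : ℕ}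

theorem addVertex_single (i : Fin n) (τ : Finset (Fin n)) (r : k) :
    addVertex i (Finsupp.single τ r) =
      if i ∈ τ then 0 else
        Finsupp.single (insert i τ) (r * (-1 : k) ^ (τ.filter (· < i)).card) := by
  unfold addVertex
  rw [Finsupp.lsum_single, LinearMap.toSpanSingleton_apply]
  split_ifs <;> simp

theorem addVertex_mem_supported {s t : Set (Finset (Fin n))} {i : Fin n}
    (h : ∀ τ ∈ s, i ∉ τ → insert i τ ∈ t) {c : Finset (Fin n) →₀ k}
    (hc : c ∈ Finsupp.supported k k s) : addVertex i c ∈ Finsupp.supported k k t := by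
  rw [Finsupp.supported_eq_span_single] at hc
  induction hc using Submodule.span_induction with
  | mem x hx =>
    obtain ⟨τ, hτ, rfl⟩ := hx
    dsimp only
    rw [addVertex_single]
    split_ifs with hi
    · exact zero_mem _
    · exact Finsupp.single_mem_supported k _ (h τ hτ hi)
  | zero => simp
  | add x y _ _ hx hy => rw [map_add]; exact add_mem hx hy
  | smul r x _ hx => rw [map_smul]; exact Submodule.smul_mem _ _ hx

theorem addVertex_card {i : Fin n} {j : ℕ} {x : Finset (Fin n) →₀ k}
    (hx : x ∈ Finsupp.supported k k {τ : Finset (Fin n) | τ.card = j}) :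
    addVertex i x ∈ Finsupp.supported k k {τ : Finset (Fin n) | τ.card = j + 1} :=
  addVertex_mem_supported (fun τ hτ hi => by
    rw [Set.mem_ofPred_eq] at hτ ⊢
    rw [Finset.card_insert_of_notMem hi, hτ]) hx

/-- Reads the map through its coefficients: the only subset that loses `i` to become `τ` is `insert
i τ`. Identities between compositions can then be checked at each `τ`. -/
theorem removeVertex_apply (i : Fin n) (x : Finset (Fin n) →₀ k) (τ : Finset (Fin n)) :
    removeVertex i x τ =
      if i ∈ τ then 0 else (-1 : k) ^ (τ.filter (· < i)).card * x (insert i τ) := by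
  induction x using Finsupp.induction_linear with
  | zero => simp
  | add x y hx hy => rw [map_add, Finsupp.add_apply, hx, hy]; split_ifs <;> simp [mul_add]
  | single σ r =>
    rw [removeVertex_single]
    by_cases hτ : i ∈ τ
    · rw [if_pos hτ]
      split_ifs with hσ
      · rw [Finsupp.single_apply, if_neg]
        rintro rfl
        simp at hτ
      · rfl
    · rw [if_neg hτ]
      split_ifs with hσ
      · by_cases h : σ = insert i τ
        · subst h
          rw [Finset.erase_insert hτ, Finsupp.single_eq_same, Finsupp.single_eq_same,
            Finset.filter_insert, if_neg (lt_irrefl i), mul_comm]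
        · rw [Finsupp.single_apply, Finsupp.single_apply, if_neg h, if_neg, mul_zero]
          rintro rfl
          exact h (Finset.insert_erase hσ).symm
      · rw [Finsupp.single_apply, if_neg, mul_zero, Finsupp.zero_apply]
        rintro rfl
        simp at hσ

theorem eq_zero_of_removeVertex_eq_zero {i : Fin n} {x : Finset (Fin n) →₀ k}
    (h : removeVertex i x = 0) {τ : Finset (Fin n)} (hτ : i ∈ τ) : x τ = 0 := by
  have h1 := removeVertex_apply i x (τ.erase i)
  rw [h, if_neg (Finset.notMem_erase i τ), Finset.insert_erase hτ, Finsupp.zero_apply] at h1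
  simpa using h1.symm

theorem removeVertex_removeVertex_self (i : Fin n) (x : Finset (Fin n) →₀ k) :
    removeVertex i (removeVertex i x) = 0 := by
  ext τ
  rw [removeVertex_apply, removeVertex_apply]
  simp

theorem neg_one_pow_card_filter_insert {i j : Fin n} {τ : Finset (Fin n)} (hi : i ∉ τ) :
    (-1 : k) ^ ((insert i τ).filter (· < j)).card =
      (if i < j then -1 else 1) * (-1 : k) ^ (τ.filter (· < j)).card := by
  rw [Finset.filter_insert]
  split_ifs with h
  · rw [Finset.card_insert_of_notMem (by simp [hi]), pow_succ, mul_comm]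
  · rw [one_mul]

theorem removeVertex_anticomm (i j : Fin n) (x : Finset (Fin n) →₀ k) :
    removeVertex i (removeVertex j x) + removeVertex j (removeVertex i x) = 0 := by
  rcases eq_or_ne i j with rfl | hij
  · simp [removeVertex_removeVertex_self]
  ext τ
  simp only [Finsupp.add_apply, Finsupp.zero_apply, removeVertex_apply, Finset.mem_insert]
  by_cases hi : i ∈ τ
  · simp [hi]
  by_cases hj : j ∈ τ
  · simp [hj]
  simp only [hi, hj, hij, hij.symm, or_false, if_false]
  rw [neg_one_pow_card_filter_insert hi, neg_one_pow_card_filter_insert hj,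
    Finset.insert_comm i j]
  rcases lt_or_gt_of_ne hij with h | h <;> simp [h, h.not_gt] <;> ring

/-- With these signs, adding `i` is the wedge product with a basis vector and removing `i` is
contraction with its dual. This lemma and the next are the Clifford relations between them. -/
theorem removeVertex_addVertex_self (i : Fin n) (x : Finset (Fin n) →₀ k) :
    removeVertex i (addVertex i x) + addVertex i (removeVertex i x) = x := by
  induction x using Finsupp.induction_linear with
  | zero => simp
  | add x y hx hy => rw [map_add, map_add, map_add, map_add, add_add_add_comm, hx, hy]
  | single τ r =>
    have hsq (m : ℕ) : r * (-1 : k) ^ m * (-1) ^ m = r := by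
      rw [mul_assoc, ← mul_pow]; simp
    rw [addVertex_single, removeVertex_single]
    by_cases hi : i ∈ τ
    · rw [if_pos hi, if_pos hi, map_zero, zero_add, addVertex_single,
        if_neg (Finset.notMem_erase i τ), Finset.insert_erase hi, Finset.filter_erase,
        Finset.erase_eq_of_notMem (by simp), hsq]
    · rw [if_neg hi, if_neg hi, map_zero, add_zero, removeVertex_single,
        if_pos (Finset.mem_insert_self i τ), Finset.erase_insert hi, Finset.filter_insert,
        if_neg (lt_irrefl i), hsq]

theorem removeVertex_addVertex {i j : Fin n} (hij : i ≠ j) (x : Finset (Fin n) →₀ k) :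
    removeVertex i (addVertex j x) + addVertex j (removeVertex i x) = 0 := by
  induction x using Finsupp.induction_linear with
  | zero => simp
  | add x y hx hy => rw [map_add, map_add, map_add, map_add, add_add_add_comm, hx, hy, add_zero]
  | single τ r =>
    rw [addVertex_single, removeVertex_single]
    by_cases hi : i ∈ τ
    · by_cases hj : j ∈ τ
      · have hj' : j ∈ τ.erase i := Finset.mem_erase.2 ⟨hij.symm, hj⟩
        rw [if_pos hj, if_pos hi, map_zero, zero_add, addVertex_single, if_pos hj']
      · obtain ⟨σ, hσ, rfl⟩ : ∃ σ, i ∉ σ ∧ insert i σ = τ :=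
          ⟨τ.erase i, Finset.notMem_erase i τ, Finset.insert_erase hi⟩
        have hjσ : j ∉ σ := fun h => hj (Finset.mem_insert_of_mem h)
        have hi' : i ∉ insert j σ := by simp [hij, hσ]
        rw [if_neg hj, if_pos hi, removeVertex_single, if_pos (Finset.mem_insert_of_mem hi),
          addVertex_single, Finset.erase_insert hσ, if_neg hjσ, Finset.insert_comm j i,
          Finset.erase_insert hi', ← Finsupp.single_add, Finset.filter_insert (a := i) (p := (· < i)),
          if_neg (lt_irrefl i), neg_one_pow_card_filter_insert hσ,
          Finset.filter_insert (a := i) (p := (· < i)), if_neg (lt_irrefl i),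
          neg_one_pow_card_filter_insert hjσ, Finsupp.single_eq_zero]
        rcases lt_or_gt_of_ne hij with h | h <;> simp [h, h.not_gt] <;> ring
    · by_cases hj : j ∈ τ
      · simp [hi, hj]
      · have hi' : i ∉ insert j τ := by simp [hij, hi]
        rw [if_neg hj, if_neg hi, map_zero, add_zero, removeVertex_single, if_neg hi']

theorem boundary_apply (x : Finset (Fin n) →₀ k) : boundary x = ∑ i, removeVertex i x := by
  rw [boundary, LinearMap.sum_apply]

/-- The diagonal needs its own hypothesis: in characteristic 2, `f i i + f i i = 0` says nothing
about `f i i`. -/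
theorem sum_sum_eq_zero_of_antisymm {ι M : Type*} [Fintype ι] [AddCommGroup M] (f : ι → ι → M)
    (h : ∀ i j, f i j + f j i = 0) (h' : ∀ i, f i i = 0) : ∑ i, ∑ j, f i j = 0 := by
  classical
  rw [← Finset.sum_product']
  refine Finset.sum_involution (fun p _ => (p.2, p.1)) (fun p _ => h _ _) ?_ (by simp) (by simp)
  rintro ⟨i, j⟩ - hp e
  obtain rfl : j = i := congrArg Prod.fst e
  exact hp (h' _)

theorem boundary_boundary (x : Finset (Fin n) →₀ k) : boundary (boundary x) = 0 := by
  rw [boundary_apply (boundary x), boundary_apply x]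
  refine (Finset.sum_congr rfl fun i _ => map_sum (removeVertex i) _ _).trans ?_
  exact sum_sum_eq_zero_of_antisymm (fun i j => removeVertex i (removeVertex j x))
    (fun i j => removeVertex_anticomm i j x) fun i => removeVertex_removeVertex_self i x

/-- The cone construction with apex `i` is a contracting homotopy on the full simplex; only the term
of the boundary that removes `i` survives. -/
theorem boundary_addVertex (i : Fin n) (x : Finset (Fin n) →₀ k) :
    boundary (addVertex i x) + addVertex i (boundary x) = x := by
  rw [boundary_apply (addVertex i x), boundary_apply x, map_sum (addVertex i)]
  refine Finset.sum_add_distrib.symm.trans ?_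
  exact (Finset.sum_eq_single i (fun j _ hj => removeVertex_addVertex hj x) (by simp)).trans
    (removeVertex_addVertex_self i x)

end Vertex

/-! ### Acyclicity of the cubical complex below `c`. -/

section Box

variable {k : Type*} [Field k] {n : ℕ}

theorem indicator_apply (τ : Finset (Fin n)) (l : Fin n) :
    indicator τ l = if l ∈ τ then 1 else 0 := by
  rw [indicator, Finsupp.finsetSum_apply]
  simp [Finsupp.single_apply]

theorem monomial_mem_of_le {I : Ideal (MvPolynomial (Fin n) k)} {u v : Fin n →₀ ℕ} (huv : u ≤ v)
    (hu : MvPolynomial.monomial u (1 : k) ∈ I) : MvPolynomial.monomial v (1 : k) ∈ I := by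
  rw [← tsub_add_cancel_of_le huv, ← one_mul (1 : k), ← MvPolynomial.monomial_mul]
  exact I.mul_mem_left _ hu

/-- A cube flat in direction `i` at height `t` may be swept upwards: the swept cube at `b` has
lowest vertex of `i`-coordinate `b i - 1 ≥ t`, so it lies above the old lowest vertex. -/
theorem insert_mem_koszulFaces {I : Ideal (MvPolynomial (Fin n) k)} {b : Fin n →₀ ℕ} {i : Fin n}
    {t : ℕ} (ht : t < b i) {τ : Finset (Fin n)} (hτ : τ ∈ koszulFaces I (b.update i t))
    (hi : i ∉ τ) : insert i τ ∈ koszulFaces I b := by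
  obtain ⟨h1, h2⟩ := hτ
  refine ⟨fun l => ?_, monomial_mem_of_le (fun l => ?_) h2⟩
  · have := h1 l
    simp only [indicator_apply, Finsupp.coe_update, Finset.mem_insert] at this ⊢
    rcases eq_or_ne l i with rfl | hl
    · simp; omega
    · simpa [hl] using this
  · have := h1 l
    simp only [indicator_apply, Finsupp.coe_update, Finsupp.coe_tsub, Pi.sub_apply,
      Finset.mem_insert] at this ⊢
    rcases eq_or_ne l i with rfl | hl
    · simp [hi]; omega
    · simp [hl]

theorem removeVertex_eq_zero_of_apply_eq_zero {I : Ideal (MvPolynomial (Fin n) k)}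
    {b : Fin n →₀ ℕ} {i : Fin n} (hb : b i = 0) {x : Finset (Fin n) →₀ k}
    (hx : x ∈ Finsupp.supported k k (koszulFaces I b)) : removeVertex i x = 0 := by
  have h := removeVertex_mem_supported (i := i) (t := (∅ : Set (Finset (Fin n))))
    (fun τ hτ hi => by
      have := hτ.1 i
      rw [indicator_apply, if_pos hi, hb] at this
      omega) hx
  simpa using h

/-- The operator `∑ j, d₁^j` applied to the difference between a family and its translates: the
differential of the cubical chain complex of `ℕ^n`, where the coefficient of the face `τ` at `b`
belongs to the cube spanned by `b - τ` and `b`. -/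
def latticeBoundary (X : (Fin n →₀ ℕ) → Finset (Fin n) →₀ k) (b : Fin n →₀ ℕ) :
    Finset (Fin n) →₀ k :=
  ∑ j, removeVertex j (X b - X (b + Finsupp.single j 1))

theorem latticeBoundary_add (X Y : (Fin n →₀ ℕ) → Finset (Fin n) →₀ k) :
    latticeBoundary (X + Y) = latticeBoundary X + latticeBoundary Y := by
  funext b
  rw [Pi.add_apply, latticeBoundary, latticeBoundary, latticeBoundary, ← Finset.sum_add_distrib]
  refine Finset.sum_congr rfl fun j _ => ?_
  rw [← map_add, Pi.add_apply, Pi.add_apply, add_sub_add_comm]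

theorem latticeBoundary_latticeBoundary (X : (Fin n →₀ ℕ) → Finset (Fin n) →₀ k) :
    latticeBoundary (latticeBoundary X) = 0 := by
  funext b
  have h : latticeBoundary (latticeBoundary X) b = ∑ i, ∑ j, removeVertex i (removeVertex j
      (X b - X (b + Finsupp.single j 1) - (X (b + Finsupp.single i 1) -
        X (b + Finsupp.single i 1 + Finsupp.single j 1)))) := by
    rw [latticeBoundary]
    refine Finset.sum_congr rfl fun i _ => ?_
    rw [latticeBoundary, latticeBoundary, ← Finset.sum_sub_distrib, map_sum (removeVertex i)]
    refine Finset.sum_congr rfl fun j _ => ?_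
    rw [← map_sub]
  rw [h]
  refine sum_sum_eq_zero_of_antisymm (fun i j => removeVertex i (removeVertex j
      (X b - X (b + Finsupp.single j 1) - (X (b + Finsupp.single i 1) -
        X (b + Finsupp.single i 1 + Finsupp.single j 1))))) (fun i j => ?_)
      fun i => removeVertex_removeVertex_self i _
  have e : X b - X (b + Finsupp.single j 1) - (X (b + Finsupp.single i 1) -
        X (b + Finsupp.single i 1 + Finsupp.single j 1)) =
      X b - X (b + Finsupp.single i 1) - (X (b + Finsupp.single j 1) -
        X (b + Finsupp.single j 1 + Finsupp.single i 1)) := by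
    rw [add_right_comm b]
    abel
  rw [e]
  exact removeVertex_anticomm i j _

/-- The families of `(j - 1)`-chains of the complexes `K^b I` that vanish unless `b ≤ c`. -/
structure IsBoxChain (I : Ideal (MvPolynomial (Fin n) k)) (c : Fin n →₀ ℕ) (j : ℕ)
    (X : (Fin n →₀ ℕ) → Finset (Fin n) →₀ k) : Prop where
  mem_faces : ∀ b, X b ∈ Finsupp.supported k k (koszulFaces I b)
  mem_card : ∀ b, X b ∈ Finsupp.supported k k {τ : Finset (Fin n) | τ.card = j}
  eq_zero : ∀ b, ¬ b ≤ c → X b = 0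

variable {I : Ideal (MvPolynomial (Fin n) k)} {c : Fin n →₀ ℕ}
  {X Y : (Fin n →₀ ℕ) → Finset (Fin n) →₀ k} {j : ℕ}

theorem IsBoxChain.add (hX : IsBoxChain I c j X) (hY : IsBoxChain I c j Y) :
    IsBoxChain I c j (X + Y) where
  mem_faces b := add_mem (hX.mem_faces b) (hY.mem_faces b)
  mem_card b := add_mem (hX.mem_card b) (hY.mem_card b)
  eq_zero b hb := by rw [Pi.add_apply, hX.eq_zero b hb, hY.eq_zero b hb, add_zero]

theorem IsBoxChain.neg (hX : IsBoxChain I c j X) : IsBoxChain I c j (-X) where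
  mem_faces b := neg_mem (hX.mem_faces b)
  mem_card b := neg_mem (hX.mem_card b)
  eq_zero b hb := by rw [Pi.neg_apply, hX.eq_zero b hb, neg_zero]

theorem IsBoxChain.latticeBoundary (hX : IsBoxChain I c (j + 1) X) :
    IsBoxChain I c j (latticeBoundary X) where
  mem_faces b := sum_mem fun i _ => by
    rw [map_sub]
    exact sub_mem
      (removeVertex_mem_supported (fun _ hτ hi => erase_mem_koszulFaces I b hτ hi) (hX.mem_faces _))
      (removeVertex_mem_supported (fun _ hτ hi => erase_mem_koszulFaces_step I b hτ hi)
        (hX.mem_faces _))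
  mem_card b := sum_mem fun i _ => removeVertex_card (sub_mem (hX.mem_card _) (hX.mem_card _))
  eq_zero b hb := Finset.sum_eq_zero fun i _ => by
    rw [hX.eq_zero b hb, hX.eq_zero _ fun h => hb (le_self_add.trans h), sub_zero, map_zero]

/-- The homotopy that contracts the box below `c` in direction `i`. -/
def boxHomotopy (c : Fin n →₀ ℕ) (i : Fin n) (X : (Fin n →₀ ℕ) → Finset (Fin n) →₀ k)
    (b : Fin n →₀ ℕ) : Finset (Fin n) →₀ k :=
  if b i ≤ c i then addVertex i (∑ t ∈ Finset.range (b i), X (b.update i t)) else 0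

/-- The projection of the box below `c` to its upper face in direction `i`. -/
def boxProjection (c : Fin n →₀ ℕ) (i : Fin n) (X : (Fin n →₀ ℕ) → Finset (Fin n) →₀ k)
    (b : Fin n →₀ ℕ) : Finset (Fin n) →₀ k :=
  if b i = c i then
    removeVertex i (addVertex i (∑ t ∈ Finset.range (c i + 1), X (b.update i t))) else 0

theorem IsBoxChain.boxHomotopy (i : Fin n) (hX : IsBoxChain I c j X) :
    IsBoxChain I c (j + 1) (boxHomotopy c i X) where
  mem_faces b := by
    unfold KoszulSplit.boxHomotopy
    split_ifs
    · rw [map_sum (addVertex i)]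
      exact sum_mem fun t ht => addVertex_mem_supported
        (fun τ hτ hi => insert_mem_koszulFaces (Finset.mem_range.1 ht) hτ hi) (hX.mem_faces _)
    · exact zero_mem _
  mem_card b := by
    unfold KoszulSplit.boxHomotopy
    split_ifs
    · exact addVertex_card (sum_mem fun t _ => hX.mem_card _)
    · exact zero_mem _
  eq_zero b hb := by
    unfold KoszulSplit.boxHomotopy
    split_ifs with h
    · rw [Finset.sum_eq_zero, map_zero]
      refine fun t _ => hX.eq_zero _ fun h' => hb fun l => ?_
      rcases eq_or_ne l i with rfl | hl
      · exact h
      · simpa [hl] using h' l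
    · rfl

theorem update_add_single_of_ne (b : Fin n →₀ ℕ) {i j : Fin n} (hij : j ≠ i) (t : ℕ) :
    (b + Finsupp.single j 1).update i t = b.update i t + Finsupp.single j 1 := by
  ext l
  rcases eq_or_ne l i with rfl | hl
  · simp [hij]
  · simp [hl]

theorem update_add_single_self (b : Fin n →₀ ℕ) (i : Fin n) (t : ℕ) :
    (b + Finsupp.single i 1).update i t = b.update i t := by
  ext l
  rcases eq_or_ne l i with rfl | hl
  · simp
  · simp [hl]

theorem update_add_single (b : Fin n →₀ ℕ) (i : Fin n) (t : ℕ) :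
    b.update i t + Finsupp.single i 1 = b.update i (t + 1) := by
  ext l
  rcases eq_or_ne l i with rfl | hl
  · simp
  · simp [hl]

/-- Sweeping in direction `i` anticommutes with facets in any other direction, so these terms
contribute nothing to the homotopy formula. -/
theorem removeVertex_boxHomotopy_of_ne (c : Fin n →₀ ℕ)
    (X : (Fin n →₀ ℕ) → Finset (Fin n) →₀ k) (b : Fin n →₀ ℕ) {i l : Fin n} (hl : l ≠ i) :
    removeVertex l (boxHomotopy c i X b - boxHomotopy c i X (b + Finsupp.single l 1)) +
      boxHomotopy c i (fun b => removeVertex l (X b - X (b + Finsupp.single l 1))) b = 0 := by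
  have hb : (b + Finsupp.single l 1 : Fin n →₀ ℕ) i = b i := by simp [hl]
  unfold boxHomotopy
  rw [hb]
  split_ifs
  · simp only [update_add_single_of_ne b hl]
    rw [← map_sub, ← Finset.sum_sub_distrib, ← map_sum (removeVertex l)]
    exact removeVertex_addVertex hl _
  · simp

/-- In direction `i` the sum over heights telescopes. Its lower end vanishes, since no cube at
height 0 extends in direction `i`; the upper end gives `-X b`, and the top face `b i = c i` keeps
the projection as well. -/
theorem IsBoxChain.removeVertex_boxHomotopy_self (hX : IsBoxChain I c j X) (i : Fin n)
    (b : Fin n →₀ ℕ) :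
    removeVertex i (KoszulSplit.boxHomotopy c i X b -
        KoszulSplit.boxHomotopy c i X (b + Finsupp.single i 1)) +
      KoszulSplit.boxHomotopy c i
        (fun b => removeVertex i (X b - X (b + Finsupp.single i 1))) b =
      boxProjection c i X b - X b := by
  have hb : (b + Finsupp.single i 1 : Fin n →₀ ℕ) i = b i + 1 := by simp
  have h0 : removeVertex i (X (b.update i 0)) = 0 :=
    removeVertex_eq_zero_of_apply_eq_zero (by simp) (hX.mem_faces _)
  have hsum : ∑ t ∈ Finset.range (b i + 1), X (b.update i t) =
      ∑ t ∈ Finset.range (b i), X (b.update i t) + X b := by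
    rw [Finset.sum_range_succ, Finsupp.update_self]
  have htel : ∑ t ∈ Finset.range (b i),
      removeVertex i (X (b.update i t) - X (b.update i t + Finsupp.single i 1)) =
        - removeVertex i (X b) := by
    simp only [update_add_single]
    rw [← map_sum (removeVertex i), Finset.sum_range_sub', Finsupp.update_self, map_sub, h0,
      zero_sub]
  have hid := removeVertex_addVertex_self i (X b)
  unfold KoszulSplit.boxHomotopy boxProjection
  rw [hb]
  simp only [update_add_single_self]
  rw [hsum, htel, map_neg]
  -- Below the top, consecutive values of the homotopy differ by one slice; at the top the second
  -- value is cut off to 0; above it everything is 0.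
  rcases lt_trichotomy (b i) (c i) with h | h | h
  · rw [if_pos h.le, if_pos (Nat.succ_le_of_lt h), if_pos h.le, if_neg h.ne, map_add (addVertex i),
      sub_add_cancel_left,
      map_neg, ← neg_add, hid, zero_sub]
  · rw [if_pos h.le, if_neg (by omega), if_pos h.le, if_pos h, ← h, hsum, map_add (addVertex i),
      map_add (removeVertex i), sub_zero]
    nth_rewrite 3 [← hid]
    abel
  · rw [if_neg (by omega), if_neg (by omega), if_neg (by omega), if_neg (by omega),
      hX.eq_zero b fun hle => absurd (hle i) (by omega)]
    simp

theorem boxHomotopy_latticeBoundary (c : Fin n →₀ ℕ) (i : Fin n)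
    (X : (Fin n →₀ ℕ) → Finset (Fin n) →₀ k) (b : Fin n →₀ ℕ) :
    boxHomotopy c i (latticeBoundary X) b = ∑ l, boxHomotopy c i
      (fun b => removeVertex l (X b - X (b + Finsupp.single l 1))) b := by
  unfold boxHomotopy
  split_ifs
  · simp only [latticeBoundary]
    rw [Finset.sum_comm, map_sum (addVertex i)]
  · simp

theorem IsBoxChain.homotopy (hX : IsBoxChain I c j X) (i : Fin n) :
    KoszulSplit.latticeBoundary (KoszulSplit.boxHomotopy c i X) +
      KoszulSplit.boxHomotopy c i (KoszulSplit.latticeBoundary X) = boxProjection c i X - X := by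
  funext b
  rw [Pi.add_apply, Pi.sub_apply, boxHomotopy_latticeBoundary, KoszulSplit.latticeBoundary]
  refine Finset.sum_add_distrib.symm.trans ?_
  exact (Finset.sum_eq_single i (fun l _ hl => removeVertex_boxHomotopy_of_ne c X b hl)
    (by simp)).trans (hX.removeVertex_boxHomotopy_self i b)

theorem boxHomotopy_zero (c : Fin n →₀ ℕ) (i : Fin n) :
    boxHomotopy c i (0 : (Fin n →₀ ℕ) → Finset (Fin n) →₀ k) = 0 := by
  funext b
  simp [boxHomotopy]

theorem IsBoxChain.exists_boxProjection (hX : IsBoxChain I c j X)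
    (h : KoszulSplit.latticeBoundary X = 0) (i : Fin n) :
    ∃ Y, IsBoxChain I c (j + 1) Y ∧ boxProjection c i X = X + KoszulSplit.latticeBoundary Y := by
  refine ⟨KoszulSplit.boxHomotopy c i X, hX.boxHomotopy i, ?_⟩
  have := hX.homotopy i
  rw [h, boxHomotopy_zero, add_zero] at this
  rw [this, add_sub_cancel]

theorem latticeBoundary_zero :
    latticeBoundary (0 : (Fin n →₀ ℕ) → Finset (Fin n) →₀ k) = 0 := by
  funext b
  simp [latticeBoundary]

theorem removeVertex_removeVertex_addVertex_eq_zero {i l : Fin n} (hl : l ≠ i)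
    {x : Finset (Fin n) →₀ k} (hx : removeVertex l x = 0) :
    removeVertex l (removeVertex i (addVertex i x)) = 0 := by
  have h := removeVertex_anticomm l i (addVertex i x)
  have h' := removeVertex_addVertex hl x
  rw [hx, map_zero, add_zero] at h'
  rwa [h', map_zero, add_zero] at h

/-- Project in one direction after another, changing the cycle by a boundary each time. The
projection in direction `i` preserves what was gained in an earlier direction `l`: it does not touch
the coordinate `b l`, and removing `l` anticommutes with adding and removing `i`. -/
theorem IsBoxChain.exists_concentrated (hX : IsBoxChain I c j X)
    (h : KoszulSplit.latticeBoundary X = 0) (s : Finset (Fin n)) :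
    ∃ Y, IsBoxChain I c (j + 1) Y ∧ ∀ i ∈ s, ∀ b,
      (b i ≠ c i → (X + KoszulSplit.latticeBoundary Y) b = 0) ∧
        removeVertex i ((X + KoszulSplit.latticeBoundary Y) b) = 0 := by
  induction s using Finset.induction with
  | empty => exact ⟨0, ⟨fun _ => zero_mem _, fun _ => zero_mem _, fun _ _ => rfl⟩, by simp⟩
  | insert i s hi ih =>
    obtain ⟨Y, hY, hYs⟩ := ih
    have hZ : IsBoxChain I c j (X + KoszulSplit.latticeBoundary Y) := hX.add hY.latticeBoundary
    obtain ⟨W, hW, hWp⟩ := hZ.exists_boxProjection (by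
      rw [latticeBoundary_add, h, latticeBoundary_latticeBoundary, add_zero]) i
    refine ⟨Y + W, hY.add hW, fun l hl b => ?_⟩
    rw [latticeBoundary_add, ← add_assoc, ← hWp]
    unfold boxProjection
    rw [Finset.mem_insert] at hl
    by_cases hli : l = i
    · subst hli
      refine ⟨fun hb => if_neg hb, ?_⟩
      split_ifs
      · exact removeVertex_removeVertex_self _ _
      · exact map_zero _
    · have hls : l ∈ s := hl.resolve_left hli
      refine ⟨fun hb => ?_, ?_⟩
      · split_ifs
        · rw [Finset.sum_eq_zero, map_zero, map_zero]
          exact fun t _ => (hYs l hls _).1 (by simpa [hli] using hb)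
        · rfl
      · split_ifs
        · refine removeVertex_removeVertex_addVertex_eq_zero hli ?_
          rw [map_sum (removeVertex l)]
          exact Finset.sum_eq_zero fun t _ => (hYs l hls _).2
        · exact map_zero _

/-- The augmentation of the box below `c`. -/
def boxAugmentation (c : Fin n →₀ ℕ) (X : (Fin n →₀ ℕ) → Finset (Fin n) →₀ k) : k :=
  ∑ b ∈ Finset.Iic c, X b ∅

/-- Only nonzero terms have to match. If `{i}` is a face at `b` then `b i ≥ 1`, so `b` is a shift;
and a shift that leaves the box carries the zero chain. -/
theorem IsBoxChain.sum_add_single (hX : IsBoxChain I c j X) (i : Fin n) :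
    ∑ b ∈ Finset.Iic c, X (b + Finsupp.single i 1) {i} = ∑ b ∈ Finset.Iic c, X b {i} := by
  refine Finset.sum_bij_ne_zero (fun b _ _ => b + Finsupp.single i 1) ?_ ?_ ?_ ?_
  · intro b _ hb
    rw [Finset.mem_Iic]
    by_contra h
    rw [hX.eq_zero _ h] at hb
    exact hb rfl
  · intro b _ _ b' _ _ h
    exact add_right_cancel h
  · intro b hb hne
    have hi : 1 ≤ b i := by
      have := (((Finsupp.mem_supported _ _).1 (hX.mem_faces b))
        (Finset.mem_coe.2 (Finsupp.mem_support_iff.2 hne))).1 i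
      simpa [indicator_apply] using this
    have e : b - Finsupp.single i 1 + Finsupp.single i 1 = b :=
      tsub_add_cancel_of_le (Finsupp.single_le_iff.2 hi)
    exact ⟨b - Finsupp.single i 1, Finset.mem_Iic.2 (tsub_le_self.trans (Finset.mem_Iic.1 hb)),
      by rwa [e], e⟩
  · intros; rfl

theorem IsBoxChain.boxAugmentation_latticeBoundary (hX : IsBoxChain I c j X) :
    boxAugmentation c (KoszulSplit.latticeBoundary X) = 0 := by
  have h (b : Fin n →₀ ℕ) : KoszulSplit.latticeBoundary X b ∅ =
      ∑ i, (X b {i} - X (b + Finsupp.single i 1) {i}) := by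
    rw [KoszulSplit.latticeBoundary, Finsupp.finsetSum_apply]
    refine Finset.sum_congr rfl fun i _ => ?_
    rw [removeVertex_apply]
    simp
  rw [boxAugmentation, Finset.sum_congr rfl fun b _ => h b, Finset.sum_comm]
  refine Finset.sum_eq_zero fun i _ => ?_
  rw [Finset.sum_sub_distrib, hX.sum_add_single, sub_self]

/-- Concentration in all directions leaves only a multiple of the vertex `c`, that is, of the empty
face at `b = c`. That multiple is 0 for reasons of dimension if `j > 0`, and by the augmentation if
`j = 0`. -/
theorem IsBoxChain.exists_latticeBoundary_eq (hX : IsBoxChain I c j X)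
    (h : KoszulSplit.latticeBoundary X = 0) (h0 : j = 0 → boxAugmentation c X = 0) :
    ∃ Y, IsBoxChain I c (j + 1) Y ∧ KoszulSplit.latticeBoundary Y = X := by
  obtain ⟨Y, hY, hYc⟩ := hX.exists_concentrated h Finset.univ
  refine ⟨-Y, hY.neg, ?_⟩
  have hZ : IsBoxChain I c j (X + KoszulSplit.latticeBoundary Y) := hX.add hY.latticeBoundary
  set Z := X + KoszulSplit.latticeBoundary Y with hZdef
  have hne (b : Fin n →₀ ℕ) (hb : b ≠ c) : Z b = 0 := by
    obtain ⟨i, hi⟩ := Finsupp.ne_iff.1 hb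
    exact (hYc i (Finset.mem_univ i) b).1 hi
  have hτ (τ : Finset (Fin n)) (hτ : τ ≠ ∅) : Z c τ = 0 := by
    obtain ⟨i, hi⟩ := Finset.nonempty_iff_ne_empty.2 hτ
    exact eq_zero_of_removeVertex_eq_zero (hYc i (Finset.mem_univ i) c).2 hi
  have hempty : Z c ∅ = 0 := by
    rcases Nat.eq_zero_or_pos j with rfl | hj
    · have h1 : boxAugmentation c Z = Z c ∅ :=
        Finset.sum_eq_single c (fun b _ hb => by rw [hne b hb, Finsupp.zero_apply]) (by simp)
      have h2 : boxAugmentation c Z =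
          boxAugmentation c X + boxAugmentation c (KoszulSplit.latticeBoundary Y) :=
        Finset.sum_add_distrib
      rw [← h1, h2, h0 rfl, hY.boxAugmentation_latticeBoundary, add_zero]
    · by_contra hc
      have := ((Finsupp.mem_supported _ _).1 (hZ.mem_card c))
        (Finset.mem_coe.2 (Finsupp.mem_support_iff.2 hc))
      simp at this
      omega
  have hz : Z = 0 := by
    funext b
    ext τ
    rcases eq_or_ne b c with rfl | hb
    · rcases eq_or_ne τ ∅ with rfl | hτ'
      · exact hempty
      · exact hτ τ hτ'
    · rw [hne b hb]; rfl
  have hneg : KoszulSplit.latticeBoundary (-Y) + KoszulSplit.latticeBoundary Y = 0 := by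
    rw [← latticeBoundary_add, neg_add_cancel, latticeBoundary_zero]
  rw [eq_neg_of_add_eq_zero_left hneg, neg_eq_iff_add_eq_zero, add_comm, ← hZdef, hz]

end Box

/-! ### The homological perturbation lemma, as identities in a ring. -/

/-- Data of the homological perturbation lemma: anticommuting differentials `p` and `q`, a
splitting `h` of `p`, and an inverse `N` of `1 - hq`. -/
structure IsPerturbation {A : Type*} [Ring A] (p q h N : A) : Prop where
  pp : p * p = 0
  qq : q * q = 0
  pq : p * q + q * p = 0
  hh : h * h = 0
  php : p * h * p = p
  hph : h * p * h = h
  inv_mul : N * (1 - h * q) = 1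
  mul_inv : (1 - h * q) * N = 1

namespace IsPerturbation

section Ring

variable {A : Type*} [Ring A] {p q h N : A}

theorem diff_diff (H : IsPerturbation p q h N) : (p - q) * (p - q) = 0 := by
  have : (p - q) * (p - q) = p * p - (p * q + q * p) + q * q := by noncomm_ring
  rw [this, H.pp, H.pq, H.qq]
  simp

theorem inv_eq (H : IsPerturbation p q h N) : N = 1 + h * q * N := by
  have := H.mul_inv
  rw [sub_mul, one_mul, sub_eq_iff_eq_add] at this
  exact this

theorem inv_eq' (H : IsPerturbation p q h N) : N = 1 + N * h * q := by
  have := H.inv_mul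
  rw [mul_sub, mul_one, sub_eq_iff_eq_add, ← mul_assoc] at this
  exact this

theorem p_mul_proj (H : IsPerturbation p q h N) : p * (1 - p * h - h * p) = 0 := by
  have : p * (1 - p * h - h * p) = p - p * p * h - p * h * p := by noncomm_ring
  rw [this, H.pp, H.php]
  simp

theorem h_mul_proj (H : IsPerturbation p q h N) : h * (1 - p * h - h * p) = 0 := by
  have : h * (1 - p * h - h * p) = h - h * p * h - h * h * p := by noncomm_ring
  rw [this, H.hh, H.hph]
  simp

theorem proj_mul_proj (H : IsPerturbation p q h N) :
    (1 - p * h - h * p) * (1 - p * h - h * p) = 1 - p * h - h * p := by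
  have : (1 - p * h - h * p) * (1 - p * h - h * p) = (1 - p * h - h * p) -
      p * (h * (1 - p * h - h * p)) - h * (p * (1 - p * h - h * p)) := by noncomm_ring
  rw [this, H.p_mul_proj, H.h_mul_proj]
  simp

/-- `N` is a chain map from the harmonic elements, with the perturbed differential, to the
complex with differential `p - q`. -/
theorem diff_mul_inv_mul_proj (H : IsPerturbation p q h N) :
    (p - q) * N * (1 - p * h - h * p) =
      -(N * (1 - p * h - h * p) * q * N * (1 - p * h - h * p)) := by
  set e := 1 - p * h - h * p with he
  have hpe : p * e = 0 := H.p_mul_proj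
  have hqu : q * ((p - q) * N * e) = -(p * q * N * e) := by
    have h1 : q * ((p - q) * N * e) = (p * q + q * p) * N * e - p * q * N * e - q * q * N * e := by
      noncomm_ring
    rw [h1, H.pq, H.qq]
    simp
  have hNe : N * e = e + h * q * N * e := by
    conv_lhs => rw [H.inv_eq]
    noncomm_ring
  have hu : (1 - h * q) * ((p - q) * N * e) = -(e * q * N * e) := by
    have h1 : (1 - h * q) * ((p - q) * N * e) =
        p * (N * e) - q * N * e - h * (q * ((p - q) * N * e)) := by noncomm_ring
    have h2 : p * (e + h * q * N * e) = p * e + p * h * q * N * e := by noncomm_ring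
    have h3 : e * q * N * e = q * N * e - p * h * q * N * e - h * p * q * N * e := by
      rw [he]; noncomm_ring
    rw [h1, hqu, hNe, h2, hpe, h3]
    noncomm_ring
  -- It suffices to know the element after multiplication by `1 - hq`, which `N` undoes.
  calc (p - q) * N * e = N * (1 - h * q) * ((p - q) * N * e) := by rw [H.inv_mul, one_mul]
    _ = N * ((1 - h * q) * ((p - q) * N * e)) := by rw [mul_assoc]
    _ = _ := by rw [hu]; noncomm_ring

/-- Multiplication by `N` on the left can be cancelled, and it turns the square of the perturbed
differential into `(p - q)² N e = 0`. -/
theorem perturbed_mul_perturbed (H : IsPerturbation p q h N) :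
    ((1 - p * h - h * p) * q * N * (1 - p * h - h * p)) *
      ((1 - p * h - h * p) * q * N * (1 - p * h - h * p)) = 0 := by
  have h1 := H.diff_mul_inv_mul_proj
  have h2 := H.proj_mul_proj
  set e := 1 - p * h - h * p
  have h3 : N * (e * q * N * e * (e * q * N * e)) = 0 := by
    calc N * (e * q * N * e * (e * q * N * e)) = N * e * q * N * (e * e) * q * N * e := by
          noncomm_ring
      _ = N * e * q * N * e * q * N * e := by rw [h2]
      _ = -(-(N * e * q * N * e)) * q * N * e := by rw [neg_neg]
      _ = -((p - q) * N * e) * q * N * e := by rw [h1]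
      _ = (p - q) * (-(N * e * q * N * e)) := by noncomm_ring
      _ = (p - q) * ((p - q) * N * e) := by rw [h1]
      _ = (p - q) * (p - q) * N * e := by noncomm_ring
      _ = 0 := by rw [H.diff_diff]; simp
  calc _ = (1 - h * q) * N * (e * q * N * e * (e * q * N * e)) := by rw [H.mul_inv, one_mul]
    _ = 0 := by rw [mul_assoc, h3, mul_zero]

/-- After this correction, every element is annihilated by `h`. -/
theorem h_mul_correction (H : IsPerturbation p q h N) :
    h * (1 - (p - q) * h * (1 + q * N * h)) = 0 := by
  -- Both occurrences of `hph` reduce to `h`, and `1 + hqN` is `N`; the four terms then cancel in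
  -- pairs.
  have h1 : h * (1 - (p - q) * h * (1 + q * N * h)) =
      h - (h * p * h) - (h * p * h) * q * N * h + h * q * (1 + h * q * N) * h := by noncomm_ring
  rw [h1, ← H.inv_eq, H.hph]
  noncomm_ring

end Ring

section Module

variable {R M : Type*} [CommRing R] [AddCommGroup M] [Module R M] {p q h N : Module.End R M}

theorem inv_injective (H : IsPerturbation p q h N) : Function.Injective N := fun x y hxy => by
  have := congrArg (1 - h * q : Module.End R M) hxy
  rwa [← Module.End.mul_apply, ← Module.End.mul_apply, H.mul_inv] at this

/-- Characterizes the image of `N` on harmonic elements: when `hy = 0` and `hpy = hqy`, the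
projection of `y` equals `(1 - hq) y`, and `N` recovers `y` from it. -/
theorem eq_inv_proj (H : IsPerturbation p q h N) {y : M} (hy : h ((p - q) y) = 0) (hy' : h y = 0) :
    y = N ((1 - p * h - h * p : Module.End R M) y) := by
  have h1 : (1 - p * h - h * p : Module.End R M) y = (1 - h * q : Module.End R M) y := by
    simp only [LinearMap.sub_apply, Module.End.mul_apply, Module.End.one_apply, hy', map_zero,
      sub_zero]
    rw [LinearMap.sub_apply, map_sub, sub_eq_zero] at hy
    rw [hy]
  rw [h1, ← Module.End.mul_apply, H.inv_mul, Module.End.one_apply]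

/-- A harmonic `x` such that `N x` is a boundary for `p - q` is a boundary for the perturbed
differential. -/
theorem exists_perturbed_eq (H : IsPerturbation p q h N) {x y : M}
    (hx : (1 - p * h - h * p : Module.End R M) x = x) (hxy : (p - q) y = N x) :
    ∃ y', y' = -(1 - p * h - h * p : Module.End R M) 
        ((1 - (p - q) * h * (1 + q * N * h) : Module.End R M) y) ∧
      (1 - p * h - h * p : Module.End R M) (q (N y')) = x ∧
      (1 - p * h - h * p : Module.End R M) y' = y' := by
  refine ⟨_, rfl, ?_, ?_⟩
  · set y₁ := (1 - (p - q) * h * (1 + q * N * h) : Module.End R M) y with hy₁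
    have hhx : h x = 0 := by
      rw [← hx, ← Module.End.mul_apply, H.h_mul_proj, LinearMap.zero_apply]
    have hhN : h (N x) = 0 := by
      rw [H.inv_eq]
      simp only [LinearMap.add_apply, Module.End.mul_apply, Module.End.one_apply, map_add]
      rw [hhx, zero_add, ← Module.End.mul_apply, H.hh, LinearMap.zero_apply]
    -- The correction changes `y` by an element of the image of `p - q`, so the perturbed boundary
    -- is unaffected.
    have hd : (p - q) y₁ = N x := by
      rw [hy₁, ← hxy, ← Module.End.mul_apply]
      have : (p - q) * (1 - (p - q) * h * (1 + q * N * h)) =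
          (p - q) - (p - q) * (p - q) * h * (1 + q * N * h) := by noncomm_ring
      rw [this, H.diff_diff]
      simp
    have hh : h y₁ = 0 := by
      rw [hy₁, ← Module.End.mul_apply, H.h_mul_correction, LinearMap.zero_apply]
    have h1 := H.eq_inv_proj (by rw [hd, hhN]) hh
    apply H.inv_injective
    -- The minus sign in this identity is the reason for the sign in `y'`.
    have h2 := LinearMap.congr_fun H.diff_mul_inv_mul_proj y₁
    simp only [Module.End.mul_apply, LinearMap.neg_apply] at h2
    rw [← h1, hd] at h2
    rw [map_neg N, map_neg q, map_neg, map_neg, h2, ← h1]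
  · rw [map_neg, ← Module.End.mul_apply, H.proj_mul_proj]

end Module

end IsPerturbation

/-! ### The perturbation data in a fixed degree `c`. -/

section BoxComplex

variable {k : Type*} [Field k] {n : ℕ} {I : Ideal (MvPolynomial (Fin n) k)}

theorem inclusion_injective (b : Fin n →₀ ℕ) : Function.Injective (inclusion I b) :=
  Subtype.val_injective

theorem inclusion_mem (b : Fin n →₀ ℕ) (x : chains I b) :
    inclusion I b x ∈ Finsupp.supported k k (koszulFaces I b) :=
  x.2

theorem inclusion_koszulBoundary (b : Fin n →₀ ℕ) (x : chains I b) :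
    inclusion I b (koszulBoundary I b x) = boundary (inclusion I b x) :=
  rfl

theorem koszulBoundary_koszulBoundary (b : Fin n →₀ ℕ) (x : chains I b) :
    koszulBoundary I b (koszulBoundary I b x) = 0 :=
  inclusion_injective b <| by
    rw [inclusion_koszulBoundary, inclusion_koszulBoundary, boundary_boundary, map_zero]

theorem removeVertex_eq_zero_of_card (i : Fin n) {x : Finset (Fin n) →₀ k}
    (hx : x ∈ Finsupp.supported k k {τ : Finset (Fin n) | τ.card = 0}) :
    removeVertex i x = 0 := by
  have h := removeVertex_mem_supported (i := i) (t := (∅ : Set (Finset (Fin n))))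
    (fun τ hτ hi => by
      rw [Set.mem_ofPred_eq, Finset.card_eq_zero] at hτ
      simp [hτ] at hi) hx
  simpa using h

theorem boundary_eq_zero_of_card {x : Finset (Fin n) →₀ k}
    (hx : x ∈ Finsupp.supported k k {τ : Finset (Fin n) | τ.card = 0}) : boundary x = 0 := by
  rw [boundary_apply]
  exact Finset.sum_eq_zero fun i _ => removeVertex_eq_zero_of_card i hx

theorem boundary_removeVertex (i : Fin n) (x : Finset (Fin n) →₀ k) :
    boundary (removeVertex i x) + removeVertex i (boundary x) = 0 := by
  rw [boundary_apply (removeVertex i x), boundary_apply x, map_sum (removeVertex i)]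
  refine Finset.sum_add_distrib.symm.trans ?_
  exact Finset.sum_eq_zero fun j _ => removeVertex_anticomm j i x

variable (I)

/-- The part of `⨁ b, C(K^b I) ⊗ k[x](-b)` in degree `c`. -/
def boxChains (c : Fin n →₀ ℕ) : Submodule k (∀ b, chains I b) where
  carrier := {x | ∀ b, ¬ b ≤ c → x b = 0}
  add_mem' hx hy b hb := by rw [Pi.add_apply, hx b hb, hy b hb, add_zero]
  zero_mem' _ _ := rfl
  smul_mem' r x hx b hb := by rw [Pi.smul_apply, hx b hb, smul_zero]

/-- The differentials `∂^b` of all `K^b I` together. -/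
def boxBoundary (c : Fin n →₀ ℕ) : Module.End k (boxChains I c) :=
  (LinearMap.pi fun b => koszulBoundary I b ∘ₗ LinearMap.proj b : Module.End k _).restrict
    fun x hx b hb => by
      change koszulBoundary I b (x b) = 0
      rw [hx b hb, map_zero]

/-- The sum of all `d₁^i`. -/
def boxStep (c : Fin n →₀ ℕ) : Module.End k (boxChains I c) :=
  (LinearMap.pi fun b => ∑ i, stepDown I b i ∘ₗ LinearMap.proj (b + Finsupp.single i 1) :
      Module.End k _).restrict fun x hx b hb => by
    rw [LinearMap.pi_apply, LinearMap.sum_apply]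
    refine Finset.sum_eq_zero fun i _ => ?_
    change stepDown I b i (x _) = 0
    rw [hx _ fun h => hb (le_self_add.trans h), map_zero]

variable {I}

/-- The splittings of all `K^b I` together. -/
def boxUp (s : ∀ b, Splitting I b) (c : Fin n →₀ ℕ) : Module.End k (boxChains I c) :=
  (LinearMap.pi fun b => (s b).up ∘ₗ LinearMap.proj b : Module.End k _).restrict
    fun x hx b hb => by
      change (s b).up (x b) = 0
      rw [hx b hb, map_zero]

variable {c : Fin n →₀ ℕ}

theorem boxChains_ext {x y : boxChains I c} (h : ∀ b, x.1 b = y.1 b) : x = y :=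
  Subtype.ext (funext h)

theorem boxStep_apply (x : boxChains I c) (b : Fin n →₀ ℕ) :
    (boxStep I c x).1 b = ∑ i, stepDown I b i (x.1 (b + Finsupp.single i 1)) := by
  change (∑ i, stepDown I b i ∘ₗ LinearMap.proj (b + Finsupp.single i 1) : _ →ₗ[k] _) x.1 = _
  rw [LinearMap.sum_apply]
  rfl

theorem inclusion_boxStep_apply (x : boxChains I c) (b : Fin n →₀ ℕ) :
    inclusion I b ((boxStep I c x).1 b) =
      ∑ i, removeVertex i (inclusion I _ (x.1 (b + Finsupp.single i 1))) := by
  rw [boxStep_apply, map_sum (inclusion I b)]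
  rfl

theorem boxUp_apply (s : ∀ b, Splitting I b) (x : boxChains I c) (b : Fin n →₀ ℕ) :
    (boxUp s c x).1 b = (s b).up (x.1 b) :=
  rfl

theorem Splitting.up_up_apply {b : Fin n →₀ ℕ} (s : Splitting I b) (x : chains I b) :
    s.up (s.up x) = 0 :=
  LinearMap.congr_fun s.up_up x

theorem Splitting.del_up_del_apply {b : Fin n →₀ ℕ} (s : Splitting I b) (x : chains I b) :
    koszulBoundary I b (s.up (koszulBoundary I b x)) = koszulBoundary I b x :=
  LinearMap.congr_fun s.del_up_del x

theorem Splitting.up_del_up_apply {b : Fin n →₀ ℕ} (s : Splitting I b) (x : chains I b) :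
    s.up (koszulBoundary I b (s.up x)) = s.up x :=
  LinearMap.congr_fun s.up_del_up x

/-- Each factor `∂⁺d₁` reads its value at `b` from indices one unit higher, so the `m`-th power
reads from total degree `b.degree + m`. Beyond `c.degree` nothing lies below `c`. -/
theorem boxUp_mul_boxStep_pow_apply_eq_zero (s : ∀ b, Splitting I b) (m : ℕ) (x : boxChains I c)
    (b : Fin n →₀ ℕ) (h : c.degree < b.degree + m) :
    (((boxUp s c * boxStep I c) ^ m) x).1 b = 0 := by
  induction m generalizing b with
  | zero =>
    refine x.2 b fun hb => ?_
    have := Finsupp.degree_mono hb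
    omega
  | succ m ih =>
    rw [pow_succ', Module.End.mul_apply, Module.End.mul_apply, boxUp_apply, boxStep_apply,
      Finset.sum_eq_zero, map_zero]
    intro i _
    rw [ih, map_zero]
    rw [map_add, Finsupp.degree_single]
    omega

/-- The inverse of `1 - ∂⁺ d₁`. -/
def boxInverse (s : ∀ b, Splitting I b) (c : Fin n →₀ ℕ) : Module.End k (boxChains I c) :=
  ∑ m ∈ Finset.range (c.degree + 1), (boxUp s c * boxStep I c) ^ m

theorem boxUp_mul_boxStep_pow_eq_zero (s : ∀ b, Splitting I b) (c : Fin n →₀ ℕ) :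
    (boxUp s c * boxStep I c) ^ (c.degree + 1) = 0 :=
  LinearMap.ext fun x => boxChains_ext fun b =>
    boxUp_mul_boxStep_pow_apply_eq_zero s _ x b (by omega)

theorem isPerturbation (s : ∀ b, Splitting I b) (c : Fin n →₀ ℕ) :
    IsPerturbation (boxBoundary I c) (boxStep I c) (boxUp s c) (boxInverse s c) where
  pp := LinearMap.ext fun x => boxChains_ext fun b => koszulBoundary_koszulBoundary b _
  qq := LinearMap.ext fun x => boxChains_ext fun b => inclusion_injective b <| by
    rw [Module.End.mul_apply, inclusion_boxStep_apply]
    simp only [inclusion_boxStep_apply]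
    refine (Finset.sum_congr rfl fun i _ => map_sum (removeVertex i) _ _).trans ?_
    refine sum_sum_eq_zero_of_antisymm (fun i j => removeVertex i (removeVertex j
      (inclusion I _ (x.1 (b + Finsupp.single i 1 + Finsupp.single j 1))))) (fun i j => ?_)
      fun i => removeVertex_removeVertex_self i _
    rw [add_right_comm b]
    exact removeVertex_anticomm i j _
  pq := LinearMap.ext fun x => boxChains_ext fun b => inclusion_injective b <| by
    change inclusion I b (koszulBoundary I b ((boxStep I c x).1 b) +
      (boxStep I c (boxBoundary I c x)).1 b) = 0
    rw [map_add, inclusion_koszulBoundary, inclusion_boxStep_apply, inclusion_boxStep_apply,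
      map_sum boundary]
    refine Finset.sum_add_distrib.symm.trans ?_
    exact Finset.sum_eq_zero fun i _ => boundary_removeVertex i _
  hh := LinearMap.ext fun x => boxChains_ext fun b => (s b).up_up_apply _
  php := LinearMap.ext fun x => boxChains_ext fun b => (s b).del_up_del_apply _
  hph := LinearMap.ext fun x => boxChains_ext fun b => (s b).up_del_up_apply _
  inv_mul := (geom_sum_mul_neg (boxUp s c * boxStep I c) _).trans <|
    (congrArg (1 - ·) (boxUp_mul_boxStep_pow_eq_zero s c)).trans <|
    sub_zero (1 : Module.End k (boxChains I c))
  mul_inv := (mul_neg_geom_sum (boxUp s c * boxStep I c) _).trans <|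
    (congrArg (1 - ·) (boxUp_mul_boxStep_pow_eq_zero s c)).trans <|
    sub_zero (1 : Module.End k (boxChains I c))

variable (I c)

/-- The elements of `boxChains` that consist of `(j - 1)`-chains. -/
def boxChainsOfCard (j : ℕ) : Submodule k (boxChains I c) where
  carrier := {x | ∀ b, x.1 b ∈ chainsOfCard I b j}
  add_mem' hx hy b := add_mem (hx b) (hy b)
  zero_mem' _ := zero_mem _
  smul_mem' r _ hx b := Submodule.smul_mem _ r (hx b)

variable {I c}

theorem boxBoundary_mem {j : ℕ} {x : boxChains I c} (hx : x ∈ boxChainsOfCard I c (j + 1)) :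
    boxBoundary I c x ∈ boxChainsOfCard I c j :=
  fun b => koszulBoundary_card I b (hx b)

theorem boxStep_mem {j : ℕ} {x : boxChains I c} (hx : x ∈ boxChainsOfCard I c (j + 1)) :
    boxStep I c x ∈ boxChainsOfCard I c j := fun b => by
  rw [boxStep_apply]
  exact sum_mem fun i _ => stepDown_card I b i (hx _)

theorem boxUp_mem (s : ∀ b, Splitting I b) {j : ℕ} {x : boxChains I c}
    (hx : x ∈ boxChainsOfCard I c j) : boxUp s c x ∈ boxChainsOfCard I c (j + 1) :=
  fun b => (s b).up_mem _ _ (hx b)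

theorem boxBoundary_eq_zero {x : boxChains I c} (hx : x ∈ boxChainsOfCard I c 0) :
    boxBoundary I c x = 0 :=
  boxChains_ext fun b => inclusion_injective b (boundary_eq_zero_of_card (hx b))

theorem boxStep_eq_zero {x : boxChains I c} (hx : x ∈ boxChainsOfCard I c 0) :
    boxStep I c x = 0 :=
  boxChains_ext fun b => inclusion_injective b <| by
    rw [inclusion_boxStep_apply]
    exact Finset.sum_eq_zero fun i _ => removeVertex_eq_zero_of_card i (hx _)

theorem boxInverse_mem (s : ∀ b, Splitting I b) {j : ℕ} {x : boxChains I c}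
    (hx : x ∈ boxChainsOfCard I c j) : boxInverse s c x ∈ boxChainsOfCard I c j := by
  rw [boxInverse, LinearMap.sum_apply]
  refine sum_mem fun m hm => ?_
  clear hm
  induction m with
  | zero => exact hx
  | succ m ih =>
    rw [pow_succ', Module.End.mul_apply, Module.End.mul_apply]
    cases j with
    | zero => rw [boxStep_eq_zero ih, map_zero]; exact zero_mem _
    | succ j => exact boxUp_mem s (boxStep_mem ih)

/-- On multiples of the empty face `d₁` is zero, so no correction terms arise. This lets the
augmentation ignore the perturbation. -/
theorem boxInverse_eq_self (s : ∀ b, Splitting I b) {x : boxChains I c}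
    (hx : x ∈ boxChainsOfCard I c 0) : boxInverse s c x = x := by
  rw [(isPerturbation s c).inv_eq', LinearMap.add_apply, Module.End.mul_apply, boxStep_eq_zero hx,
    map_zero, add_zero, Module.End.one_apply]

/-- The bridge between the two pictures: the unperturbed differential minus the perturbation is the
cubical boundary. -/
theorem inclusion_boxBoundary_sub_boxStep (x : boxChains I c) (b : Fin n →₀ ℕ) :
    inclusion I b (((boxBoundary I c - boxStep I c) x).1 b) =
      latticeBoundary (fun b => inclusion I b (x.1 b)) b := by
  change inclusion I b (koszulBoundary I b (x.1 b) - (boxStep I c x).1 b) = _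
  rw [map_sub, inclusion_koszulBoundary, inclusion_boxStep_apply, boundary_apply, latticeBoundary]
  refine (Finset.sum_sub_distrib _ _).symm.trans ?_
  exact Finset.sum_congr rfl fun i _ => (map_sub (removeVertex i) _ _).symm

theorem isBoxChain {j : ℕ} {x : boxChains I c} (hx : x ∈ boxChainsOfCard I c j) :
    IsBoxChain I c j fun b => inclusion I b (x.1 b) where
  mem_faces b := inclusion_mem b _
  mem_card := hx
  eq_zero b hb := by rw [x.2 b hb, map_zero]

/-- The coefficient of the augmentation of an element in degree `c`. -/
def augmentation (x : boxChains I c) : k := boxAugmentation c fun b => inclusion I b (x.1 b)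

theorem augmentation_add (x y : boxChains I c) :
    augmentation (x + y) = augmentation x + augmentation y :=
  Finset.sum_add_distrib

theorem augmentation_neg (x : boxChains I c) : augmentation (-x) = -augmentation x :=
  Finset.sum_neg_distrib _

theorem augmentation_diff {j : ℕ} {x : boxChains I c} (hx : x ∈ boxChainsOfCard I c j) :
    augmentation ((boxBoundary I c - boxStep I c) x) = 0 := by
  rw [augmentation]
  simp only [inclusion_boxBoundary_sub_boxStep]
  exact (isBoxChain hx).boxAugmentation_latticeBoundary

theorem exists_diff_eq {j : ℕ} {x : boxChains I c} (hx : x ∈ boxChainsOfCard I c j)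
    (h : (boxBoundary I c - boxStep I c) x = 0) (h0 : j = 0 → augmentation x = 0) :
    ∃ y ∈ boxChainsOfCard I c (j + 1), (boxBoundary I c - boxStep I c) y = x := by
  obtain ⟨Y, hY, hYx⟩ := (isBoxChain hx).exists_latticeBoundary_eq (by
    funext b
    rw [← inclusion_boxBoundary_sub_boxStep, h]
    rfl) h0
  let y : boxChains I c := ⟨fun b => ⟨Y b, hY.mem_faces b⟩, fun b hb => Subtype.ext (hY.eq_zero b hb)⟩
  refine ⟨y, hY.mem_card, boxChains_ext fun b => inclusion_injective b ?_⟩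
  rw [inclusion_boxBoundary_sub_boxStep]
  exact congrFun hYx b

end BoxComplex

/-! ### Lattice paths as the expansion of the geometric series. -/

section Paths

variable {k : Type*} [Field k] {n : ℕ} {I : Ideal (MvPolynomial (Fin n) k)} {c : Fin n →₀ ℕ}

/-- The first step of a path, together with the rest of the path if there is one. -/
def LatticePath.split {a : Fin n →₀ ℕ} :
    (Σ b, LatticePath a b) → Fin n ⊕ Fin n × Σ b, LatticePath a b
  | ⟨_, .step i⟩ => Sum.inl i
  | ⟨_, .cons i p⟩ => Sum.inr (i, ⟨_, p⟩)

theorem LatticePath.split_injective {a : Fin n →₀ ℕ} :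
    Function.Injective (LatticePath.split (a := a)) := by
  rintro ⟨_, p⟩ ⟨_, q⟩ h
  cases p <;> cases q <;> simp only [LatticePath.split, Sum.inl.injEq, Sum.inr.injEq,
    Prod.mk.injEq, Sigma.mk.injEq, reduceCtorEq] at h
  · subst h; rfl
  · obtain ⟨rfl, rfl, h⟩ := h
    cases h
    rfl

theorem LatticePath.lt {a b : Fin n →₀ ℕ} (p : LatticePath a b) : a < b := by
  induction p with
  | step i => exact lt_of_le_of_ne le_self_add (by simp)
  | cons i p ih => exact ih.trans_le le_self_add

/-- The sum over all paths that end in `a`. -/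
def pathTransport (s : ∀ b, Splitting I b) (c a : Fin n →₀ ℕ) :
    boxChains I c →ₗ[k] chains I a :=
  ∑ b ∈ Finset.Iic c, (∑ p : LatticePath a b, p.transport s) ∘ₗ LinearMap.proj b ∘ₗ
    (boxChains I c).subtype

theorem pathTransport_apply (s : ∀ b, Splitting I b) (a : Fin n →₀ ℕ) (x : boxChains I c) :
    pathTransport s c a x = ∑ b ∈ Finset.Iic c, ∑ p : LatticePath a b, p.transport s (x.1 b) := by
  rw [pathTransport, LinearMap.sum_apply]
  refine Finset.sum_congr rfl fun b _ => ?_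
  rw [LinearMap.comp_apply, LinearMap.sum_apply]
  rfl

/-- Sorts the paths by their first step: either it is the whole path, or a path from a lower index
follows. -/
theorem pathTransport_eq_add (s : ∀ b, Splitting I b) (a : Fin n →₀ ℕ) (x : boxChains I c) :
    pathTransport s c a x =
      (boxStep I c x).1 a + pathTransport s c a (boxUp s c (boxStep I c x)) := by
  let g : (Fin n ⊕ Fin n × Σ b, LatticePath a b) → chains I a := fun e => e.elim
    (fun i => stepDown I a i (x.1 (a + Finsupp.single i 1)))
    (fun e => e.2.2.transport s ((s e.2.1).up
      (stepDown I e.2.1 e.1 (x.1 (e.2.1 + Finsupp.single e.1 1)))))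
  let F : Finset (Σ b, LatticePath a b) := (Finset.Iic c).sigma fun _ => Finset.univ
  have h1 : pathTransport s c a x = ∑ e ∈ F, e.2.transport s (x.1 e.1) := by
    rw [pathTransport_apply, Finset.sum_sigma]
  have h2 : (boxStep I c x).1 a + pathTransport s c a (boxUp s c (boxStep I c x)) =
      ∑ e ∈ (Finset.univ : Finset (Fin n)).disjSum (Finset.univ ×ˢ F), g e := by
    rw [Finset.sum_disjSum, boxStep_apply, Finset.sum_product_right, Finset.sum_sigma,
      pathTransport_apply]
    congr 1
    refine Finset.sum_congr rfl fun b _ => Finset.sum_congr rfl fun p _ => ?_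
    rw [boxUp_apply, boxStep_apply, map_sum, map_sum]
    rfl
  rw [h1, h2]
  -- Splitting is injective but misses the terms whose first step starts outside the box; there `x`
  -- is zero.
  refine Finset.sum_of_injOn LatticePath.split LatticePath.split_injective.injOn ?_ ?_ ?_
  · rintro ⟨b, p⟩ hp
    simp only [F, Finset.coe_sigma, Set.mem_sigma_iff, Finset.mem_coe, Finset.mem_Iic] at hp
    cases p with
    | step i => simp [LatticePath.split]
    | cons i p => simpa [LatticePath.split, F] using le_self_add.trans hp.1
  · rintro (i | ⟨i, b, p⟩) - hn
    · have : ¬ a + Finsupp.single i 1 ≤ c := fun h =>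
        hn ⟨⟨_, .step i⟩, by simpa [F] using h, rfl⟩
      simp only [g, Sum.elim_inl]
      rw [x.2 _ this, map_zero]
    · have : ¬ b + Finsupp.single i 1 ≤ c := fun h =>
        hn ⟨⟨_, .cons i p⟩, by simpa [F] using h, rfl⟩
      simp only [g, Sum.elim_inr]
      rw [x.2 _ this, map_zero, map_zero, map_zero]
  · rintro ⟨b, p⟩ -
    cases p <;> rfl

/-- The recursion says `T = q + T h q` for the path sum `T`, so `T (1 - hq) = q`; applying this to
`N x` solves for `T`. -/
theorem pathTransport_eq (s : ∀ b, Splitting I b) (a : Fin n →₀ ℕ) (x : boxChains I c) :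
    pathTransport s c a x = (boxStep I c (boxInverse s c x)).1 a := by
  have h := pathTransport_eq_add s a (boxInverse s c x)
  rw [← sub_eq_iff_eq_add, ← map_sub] at h
  rw [← h]
  congr 1
  have := LinearMap.congr_fun (isPerturbation s c).mul_inv x
  exact this.symm

end Paths

/-! ### Harmonic representatives and exactness in degree `c`. -/

section Homology

variable {k : Type*} [Field k] {n : ℕ} {I : Ideal (MvPolynomial (Fin n) k)}

/-- The projection `1 - ∂∂⁺ - ∂⁺∂` to the harmonic chains. -/
def harmonicProjection {b : Fin n →₀ ℕ} (s : Splitting I b) : chains I b →ₗ[k] chains I b :=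
  LinearMap.id - koszulBoundary I b ∘ₗ s.up - s.up ∘ₗ koszulBoundary I b

theorem harmonicProjection_apply {b : Fin n →₀ ℕ} (s : Splitting I b) (x : chains I b) :
    harmonicProjection s x = x - koszulBoundary I b (s.up x) - s.up (koszulBoundary I b x) :=
  rfl

/-- The harmonic representative of a homology class. -/
def harmonicRep {b : Fin n →₀ ℕ} (s : Splitting I b) (j : ℕ) : homology I b j →ₗ[k] chains I b :=
  Submodule.liftQ _ (harmonicProjection s ∘ₗ (cycles I b j).subtype) fun z hz => by
    obtain ⟨x, -, hx⟩ := hz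
    have hx' : koszulBoundary I b x = z.1 := hx
    rw [LinearMap.mem_ker]
    change harmonicProjection s z.1 = 0
    rw [← hx', harmonicProjection_apply, s.del_up_del_apply, koszulBoundary_koszulBoundary]
    simp

theorem harmonicRep_mk {b : Fin n →₀ ℕ} (s : Splitting I b) (j : ℕ) (z : cycles I b j) :
    harmonicRep s j (Submodule.Quotient.mk z) = z.1 - koszulBoundary I b (s.up z.1) := by
  have hz : koszulBoundary I b z.1 = 0 := z.2.2
  change harmonicProjection s z.1 = _
  rw [harmonicProjection_apply, hz, map_zero, sub_zero]

/-- If the harmonic part of a cycle `z` is zero, then `z = ∂∂⁺z` is a boundary. -/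
theorem harmonicRep_injective {b : Fin n →₀ ℕ} (s : Splitting I b) (j : ℕ) :
    Function.Injective (harmonicRep s j) := by
  rw [injective_iff_map_eq_zero]
  intro h hh
  obtain ⟨z, rfl⟩ := Submodule.Quotient.mk_surjective _ h
  rw [harmonicRep_mk, sub_eq_zero] at hh
  exact (Submodule.Quotient.mk_eq_zero _).2 ⟨s.up z.1, s.up_mem _ _ z.2.1, hh.symm⟩

theorem harmonicRep_mem {b : Fin n →₀ ℕ} (s : Splitting I b) (j : ℕ) (h : homology I b j) :
    harmonicRep s j h ∈ chainsOfCard I b j := by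
  obtain ⟨z, rfl⟩ := Submodule.Quotient.mk_surjective _ h
  rw [harmonicRep_mk]
  exact sub_mem z.2.1 (koszulBoundary_card I b (s.up_mem _ _ z.2.1))

theorem harmonicProjection_harmonicRep {b : Fin n →₀ ℕ} (s : Splitting I b) (j : ℕ)
    (h : homology I b j) : harmonicProjection s (harmonicRep s j h) = harmonicRep s j h := by
  obtain ⟨z, rfl⟩ := Submodule.Quotient.mk_surjective _ h
  have hz : koszulBoundary I b z.1 = 0 := z.2.2
  rw [harmonicRep_mk, harmonicProjection_apply, map_sub, map_sub, map_sub, hz, s.up_del_up_apply,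
    koszulBoundary_koszulBoundary]
  simp

theorem exists_harmonicRep_eq {b : Fin n →₀ ℕ} (s : Splitting I b) (j : ℕ) {x : chains I b}
    (hx : x ∈ chainsOfCard I b j) (h : harmonicProjection s x = x) :
    ∃ z, harmonicRep s j z = x := by
  have h1 : koszulBoundary I b x = 0 := by
    rw [← h, harmonicProjection_apply, map_sub, map_sub, koszulBoundary_koszulBoundary,
      s.del_up_del_apply]
    simp
  refine ⟨Submodule.Quotient.mk ⟨x, hx, h1⟩, ?_⟩
  rw [harmonicRep_mk]
  rw [harmonicProjection_apply, h1, map_zero, sub_zero] at h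
  exact h

/-- On a cycle the right factor `1 - ∂∂⁺` of `D` already gives the harmonic representative. On the
left, `∂⁺∂⁺ = 0` gives `(1 - ∂∂⁺)(1 - ∂⁺∂) = 1 - ∂∂⁺ - ∂⁺∂`. -/
theorem harmonicRep_homologyMap (s : ∀ b, Splitting I b) (a b : Fin n →₀ ℕ) (j : ℕ)
    (h : homology I b (j + 1)) :
    harmonicRep (s a) j (homologyMap s a b j h) = harmonicProjection (s a)
      (∑ p : LatticePath a b, p.transport s (harmonicRep (s b) (j + 1) h)) := by
  obtain ⟨z, rfl⟩ := Submodule.Quotient.mk_surjective _ h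
  have h1 : homologyMap s a b j (Submodule.Quotient.mk z) =
      Submodule.Quotient.mk ⟨pathSum s a b z.1, pathSum_mem_cycles s a b j _ z.2⟩ := rfl
  have h2 : pathSum s a b z.1 =
      ∑ p : LatticePath a b, (p.transport s (z.1 - koszulBoundary I b ((s b).up z.1)) -
        (s a).up (koszulBoundary I a
          (p.transport s (z.1 - koszulBoundary I b ((s b).up z.1))))) := by
    rw [pathSum, LinearMap.sum_apply]
    rfl
  rw [h1, harmonicRep_mk, harmonicRep_mk]
  change pathSum s a b z.1 - koszulBoundary I a ((s a).up (pathSum s a b z.1)) = _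
  rw [h2, Finset.sum_sub_distrib, ← map_sum, ← map_sum,
    harmonicProjection_apply, map_sub, (s a).up_up_apply, sub_zero]
  abel

variable {c : Fin n →₀ ℕ}

/-- The family of harmonic representatives of a family of homology classes. -/
def boxRep (s : ∀ b, Splitting I b) {j : ℕ} (x : ∀ b, homology I b j)
    (hx : ∀ b, ¬ b ≤ c → x b = 0) : boxChains I c :=
  ⟨fun b => harmonicRep (s b) j (x b), fun b hb => by
    dsimp only
    rw [hx b hb, map_zero]⟩

/-- The differential of the resolution in degree `c`. -/
def degreeDiff (s : ∀ b, Splitting I b) (c : Fin n →₀ ℕ) (j : ℕ) (x : ∀ b, homology I b (j + 1))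
    (a : Fin n →₀ ℕ) : homology I a j :=
  ∑ b ∈ Finset.Iic c, homologyMap s a b j (x b)

theorem homologyMap_eq_zero (s : ∀ b, Splitting I b) {a b : Fin n →₀ ℕ} (j : ℕ) (hab : ¬ a < b) :
    homologyMap s a b j = 0 := by
  have : IsEmpty (LatticePath a b) := ⟨fun p => hab p.lt⟩
  refine LinearMap.ext fun h => harmonicRep_injective (s a) j ?_
  rw [harmonicRep_homologyMap, Finset.univ_eq_empty, Finset.sum_empty]
  simp

theorem degreeDiff_eq_zero (s : ∀ b, Splitting I b) (j : ℕ) (x : ∀ b, homology I b (j + 1))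
    (a : Fin n →₀ ℕ) (ha : ¬ a ≤ c) : degreeDiff s c j x a = 0 :=
  Finset.sum_eq_zero fun b hb => by
    rw [homologyMap_eq_zero s j fun h => ha (h.le.trans (Finset.mem_Iic.1 hb)),
      LinearMap.zero_apply]

theorem boxProj_apply (s : ∀ b, Splitting I b) (x : boxChains I c) (b : Fin n →₀ ℕ) :
    ((1 - boxBoundary I c * boxUp s c - boxUp s c * boxBoundary I c :
      Module.End k (boxChains I c)) x).1 b = harmonicProjection (s b) (x.1 b) :=
  rfl

theorem boxProj_boxRep (s : ∀ b, Splitting I b) {j : ℕ} (x : ∀ b, homology I b j)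
    (hx : ∀ b, ¬ b ≤ c → x b = 0) :
    (1 - boxBoundary I c * boxUp s c - boxUp s c * boxBoundary I c :
      Module.End k (boxChains I c)) (boxRep s x hx) = boxRep s x hx :=
  boxChains_ext fun _ => harmonicProjection_harmonicRep _ _ _

theorem boxRep_mem (s : ∀ b, Splitting I b) {j : ℕ} (x : ∀ b, homology I b j)
    (hx : ∀ b, ¬ b ≤ c → x b = 0) : boxRep s x hx ∈ boxChainsOfCard I c j :=
  fun _ => harmonicRep_mem _ _ _

theorem exists_boxRep_eq (s : ∀ b, Splitting I b) {j : ℕ} {y : boxChains I c}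
    (hy : y ∈ boxChainsOfCard I c j)
    (h : (1 - boxBoundary I c * boxUp s c - boxUp s c * boxBoundary I c :
      Module.End k (boxChains I c)) y = y) :
    ∃ (x : ∀ b, homology I b j) (hx : ∀ b, ¬ b ≤ c → x b = 0), boxRep s x hx = y := by
  choose x hx using fun b => exists_harmonicRep_eq (s b) j (hy b)
    (congrFun (congrArg Subtype.val h) b)
  refine ⟨x, fun b hb => ?_, boxChains_ext hx⟩
  apply harmonicRep_injective (s b) j
  rw [hx, y.2 b hb, map_zero]

/-- Identifies the differential defined by paths with `eqNe` on harmonic families; the perturbation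
lemma applies from here on. -/
theorem boxRep_degreeDiff (s : ∀ b, Splitting I b) {j : ℕ} (x : ∀ b, homology I b (j + 1))
    (hx : ∀ b, ¬ b ≤ c → x b = 0) :
    boxRep s (degreeDiff s c j x) (degreeDiff_eq_zero s j x) =
      (1 - boxBoundary I c * boxUp s c - boxUp s c * boxBoundary I c :
        Module.End k (boxChains I c)) (boxStep I c (boxInverse s c (boxRep s x hx))) := by
  refine boxChains_ext fun a => ?_
  rw [boxProj_apply, ← pathTransport_eq, pathTransport_apply, map_sum]
  change harmonicRep (s a) j (∑ b ∈ Finset.Iic c, homologyMap s a b j (x b)) = _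
  rw [map_sum]
  exact Finset.sum_congr rfl fun b _ => harmonicRep_homologyMap s a b j (x b)

theorem boxRep_injective (s : ∀ b, Splitting I b) {j : ℕ} {x y : ∀ b, homology I b j}
    {hx : ∀ b, ¬ b ≤ c → x b = 0} {hy : ∀ b, ¬ b ≤ c → y b = 0}
    (h : boxRep s x hx = boxRep s y hy) : x = y :=
  funext fun b => harmonicRep_injective (s b) j (congrFun (congrArg Subtype.val h) b)

theorem boxRep_zero (s : ∀ b, Splitting I b) {j : ℕ} (h : ∀ b, ¬ b ≤ c → (0 : homology I b j) = 0) :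
    boxRep s (fun b => (0 : homology I b j)) h = 0 :=
  boxChains_ext fun _ => map_zero _

theorem perturbed_boxRep (s : ∀ b, Splitting I b) {j : ℕ} (x : ∀ b, homology I b (j + 1))
    (hx : ∀ b, ¬ b ≤ c → x b = 0) :
    (boxBoundary I c - boxStep I c) (boxInverse s c (boxRep s x hx)) =
      -boxInverse s c (boxRep s (degreeDiff s c j x) (degreeDiff_eq_zero s j x)) := by
  have h := LinearMap.congr_fun (isPerturbation s c).diff_mul_inv_mul_proj (boxRep s x hx)
  simp only [Module.End.mul_apply, LinearMap.neg_apply] at h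
  rwa [boxProj_boxRep, ← boxRep_degreeDiff] at h

theorem degreeDiff_degreeDiff (s : ∀ b, Splitting I b) {j : ℕ} (x : ∀ b, homology I b (j + 2))
    (hx : ∀ b, ¬ b ≤ c → x b = 0) : degreeDiff s c j (degreeDiff s c (j + 1) x) = 0 := by
  apply boxRep_injective s (hx := degreeDiff_eq_zero s j _) (hy := fun _ _ => rfl)
  have h := LinearMap.congr_fun (isPerturbation s c).perturbed_mul_perturbed (boxRep s x hx)
  simp only [Module.End.mul_apply, LinearMap.zero_apply] at h
  rw [boxProj_boxRep, ← boxRep_degreeDiff, boxProj_boxRep, ← boxRep_degreeDiff] at h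
  rw [h]
  exact (boxRep_zero s _).symm

/-- A preimage of `N x` under `p - q` exists by acyclicity of the box; the perturbation lemma makes
it harmonic. The chain dimension has to be followed through the explicit formula for `y'`, to know
that it represents classes in the right homology. -/
theorem exists_degreeDiff_eq (s : ∀ b, Splitting I b) {j : ℕ} (x : ∀ b, homology I b j)
    (hx : ∀ b, ¬ b ≤ c → x b = 0)
    (h : (boxBoundary I c - boxStep I c) (boxInverse s c (boxRep s x hx)) = 0)
    (h0 : j = 0 → augmentation (boxInverse s c (boxRep s x hx)) = 0) :
    ∃ y : ∀ b, homology I b (j + 1), (∀ b, ¬ b ≤ c → y b = 0) ∧ degreeDiff s c j y = x := by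
  obtain ⟨w, hw, hwx⟩ := exists_diff_eq (boxInverse_mem s (boxRep_mem s x hx)) h h0
  obtain ⟨y', hy', hy'x, hy'h⟩ :=
    (isPerturbation s c).exists_perturbed_eq (boxProj_boxRep s x hx) hwx
  have hmem : y' ∈ boxChainsOfCard I c (j + 1) := by
    have h1 {m : ℕ} {v : boxChains I c} (hv : v ∈ boxChainsOfCard I c (m + 1)) :
        (1 - boxBoundary I c * boxUp s c - boxUp s c * boxBoundary I c :
          Module.End k (boxChains I c)) v ∈ boxChainsOfCard I c (m + 1) :=
      sub_mem (sub_mem hv (boxBoundary_mem (boxUp_mem s hv))) (boxUp_mem s (boxBoundary_mem hv))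
    have h2 {m : ℕ} {v : boxChains I c} (hv : v ∈ boxChainsOfCard I c (m + 1)) :
        (boxBoundary I c - boxStep I c) v ∈ boxChainsOfCard I c m :=
      sub_mem (boxBoundary_mem hv) (boxStep_mem hv)
    rw [hy']
    refine neg_mem (h1 (sub_mem hw (h2 (boxUp_mem s (add_mem hw ?_)))))
    exact boxStep_mem (boxInverse_mem s (boxUp_mem s hw))
  obtain ⟨y, hy, rfl⟩ := exists_boxRep_eq s hmem hy'h
  refine ⟨y, hy, ?_⟩
  rw [← boxRep_degreeDiff] at hy'x
  exact boxRep_injective s hy'x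

theorem exact_degreeDiff (s : ∀ b, Splitting I b) {j : ℕ} (x : ∀ b, homology I b (j + 1))
    (hx : ∀ b, ¬ b ≤ c → x b = 0) (h : degreeDiff s c j x = 0) :
    ∃ y : ∀ b, homology I b (j + 2), (∀ b, ¬ b ≤ c → y b = 0) ∧ degreeDiff s c (j + 1) y = x := by
  refine exists_degreeDiff_eq s x hx ?_ (by simp)
  rw [perturbed_boxRep, neg_eq_zero]
  have : boxRep s (degreeDiff s c j x) (degreeDiff_eq_zero s j x) = 0 :=
    boxChains_ext fun b => by
      change harmonicRep (s b) j (degreeDiff s c j x b) = 0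
      rw [h]
      exact map_zero _
  rw [this, map_zero]

/-- The coefficient `H̃_(-1)(K^b I) → k` of the augmentation: the coefficient of the empty face in
the harmonic representative. -/
def homologyAugmentation {b : Fin n →₀ ℕ} (s : Splitting I b) : homology I b 0 →ₗ[k] k :=
  Finsupp.lapply ∅ ∘ₗ inclusion I b ∘ₗ harmonicRep s 0

theorem augmentation_boxRep (s : ∀ b, Splitting I b) (x : ∀ b, homology I b 0)
    (hx : ∀ b, ¬ b ≤ c → x b = 0) :
    augmentation (boxRep s x hx) = ∑ b ∈ Finset.Iic c, homologyAugmentation (s b) (x b) :=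
  rfl

theorem sum_homologyAugmentation_degreeDiff (s : ∀ b, Splitting I b)
    (x : ∀ b, homology I b 1) (hx : ∀ b, ¬ b ≤ c → x b = 0) :
    ∑ b ∈ Finset.Iic c, homologyAugmentation (s b) (degreeDiff s c 0 x b) = 0 := by
  rw [← augmentation_boxRep s _ (degreeDiff_eq_zero s 0 x),
    ← boxInverse_eq_self s (boxRep_mem s _ _), ← neg_eq_zero, ← augmentation_neg,
    ← perturbed_boxRep s x hx]
  exact augmentation_diff (boxInverse_mem s (boxRep_mem s x hx))

theorem diff_eq_zero {x : boxChains I c} (hx : x ∈ boxChainsOfCard I c 0) :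
    (boxBoundary I c - boxStep I c) x = 0 := by
  rw [LinearMap.sub_apply, boxBoundary_eq_zero hx, boxStep_eq_zero hx, sub_zero]

theorem exact_homologyAugmentation (s : ∀ b, Splitting I b) (x : ∀ b, homology I b 0)
    (hx : ∀ b, ¬ b ≤ c → x b = 0)
    (h : ∑ b ∈ Finset.Iic c, homologyAugmentation (s b) (x b) = 0) :
    ∃ y : ∀ b, homology I b 1, (∀ b, ¬ b ≤ c → y b = 0) ∧ degreeDiff s c 0 y = x := by
  refine exists_degreeDiff_eq s x hx ?_ fun _ => ?_
  · rw [boxInverse_eq_self s (boxRep_mem s x hx), diff_eq_zero (boxRep_mem s x hx)]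
  · rw [boxInverse_eq_self s (boxRep_mem s x hx), augmentation_boxRep, h]

/-- The vertex `c` has augmentation 1. Subtracting a cubical boundary makes it harmonic and keeps
the augmentation. -/
theorem exists_sum_homologyAugmentation_eq_one (s : ∀ b, Splitting I b)
    (hc : MvPolynomial.monomial c (1 : k) ∈ I) :
    ∃ x : ∀ b, homology I b 0, (∀ b, ¬ b ≤ c → x b = 0) ∧
      ∑ b ∈ Finset.Iic c, homologyAugmentation (s b) (x b) = 1 := by
  classical
  let t₀ : chains I c := ⟨Finsupp.single ∅ 1, Finsupp.single_mem_supported k _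
    ⟨by simp [indicator], by simpa [indicator] using hc⟩⟩
  let t : boxChains I c := ⟨Pi.single c t₀, fun b hb =>
    Pi.single_eq_of_ne (fun h => hb h.le) _⟩
  have ht : t ∈ boxChainsOfCard I c 0 := fun b => by
    rcases eq_or_ne b c with rfl | hb
    · have : t.1 b = t₀ := Pi.single_eq_same _ _
      rw [this]
      exact Finsupp.single_mem_supported k _ rfl
    · have : t.1 b = 0 := Pi.single_eq_of_ne hb _
      rw [this]
      exact zero_mem _
  have hta : augmentation t = 1 := by
    refine (Finset.sum_eq_single c (fun b _ hb => ?_) (by simp)).trans ?_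
    · have : t.1 b = 0 := Pi.single_eq_of_ne hb _
      dsimp only
      rw [this, map_zero, Finsupp.zero_apply]
    · have : t.1 c = t₀ := Pi.single_eq_same _ _
      dsimp only
      rw [this]
      exact Finsupp.single_eq_same
  set y := (1 - (boxBoundary I c - boxStep I c) * boxUp s c *
    (1 + boxStep I c * boxInverse s c * boxUp s c) : Module.End k (boxChains I c)) t with hy
  have hz : boxUp s c (t + boxStep I c (boxInverse s c (boxUp s c t))) ∈ boxChainsOfCard I c 1 :=
    boxUp_mem s (add_mem ht (boxStep_mem (boxInverse_mem s (boxUp_mem s ht))))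
  have hyt : y = t - (boxBoundary I c - boxStep I c)
      (boxUp s c (t + boxStep I c (boxInverse s c (boxUp s c t)))) := rfl
  have hy0 : y ∈ boxChainsOfCard I c 0 := by
    rw [hyt]
    exact sub_mem ht (sub_mem (boxBoundary_mem hz) (boxStep_mem hz))
  have hup : boxUp s c y = 0 := by
    rw [hy, ← Module.End.mul_apply, (isPerturbation s c).h_mul_correction, LinearMap.zero_apply]
  -- In the lowest dimension `∂` is zero, so being killed by `∂⁺` is enough to be harmonic.
  have hyh : (1 - boxBoundary I c * boxUp s c - boxUp s c * boxBoundary I c :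
      Module.End k (boxChains I c)) y = y := by
    simp only [LinearMap.sub_apply, Module.End.mul_apply, Module.End.one_apply, hup,
      boxBoundary_eq_zero hy0, map_zero, sub_zero]
  obtain ⟨x, hx, hxy⟩ := exists_boxRep_eq s hy0 hyh
  refine ⟨x, hx, ?_⟩
  rw [← augmentation_boxRep s x hx, hxy, hyt, sub_eq_add_neg, augmentation_add, augmentation_neg,
    augmentation_diff hz, hta, neg_zero, add_zero]

end Homology

/-! ### Finite generation. -/

section Finiteness

variable {k : Type*} [Field k] {n : ℕ} {I : Ideal (MvPolynomial (Fin n) k)}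

/-- Take for `m` the join of the exponents of finitely many monomial generators: a generator
dividing `x^u` also divides `x^(u ⊓ m)`. -/
theorem IsMonomialIdeal.exists_bound (hI : IsMonomialIdeal I) :
    ∃ m : Fin n →₀ ℕ, ∀ u : Fin n →₀ ℕ, MvPolynomial.monomial u (1 : k) ∈ I →
      MvPolynomial.monomial (u ⊓ m) (1 : k) ∈ I := by
  classical
  obtain ⟨S, rfl⟩ := hI
  obtain ⟨t, hts, ht⟩ := Submodule.fg_span_iff_fg_span_finset_subset _ |>.1
    (IsNoetherian.noetherian
      (Ideal.span ((fun u => MvPolynomial.monomial u (1 : k)) '' S)))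
  obtain ⟨S', hS', rfl⟩ := Finset.subset_set_image_iff.1 hts
  have hspan : Ideal.span ((fun u => MvPolynomial.monomial u (1 : k)) '' S) =
      Ideal.span ((fun u => MvPolynomial.monomial u (1 : k)) '' (S' : Set (Fin n →₀ ℕ))) := by
    rw [Finset.coe_image] at ht
    exact ht
  refine ⟨S'.sup id, fun u hu => ?_⟩
  rw [hspan, MvPolynomial.mem_ideal_span_monomial_image] at hu ⊢
  intro v hv
  obtain ⟨w, hw, hwu⟩ := hu u (by simp [MvPolynomial.support_monomial])
  rw [MvPolynomial.support_monomial, if_neg one_ne_zero, Finset.mem_singleton] at hv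
  exact ⟨w, hw, hv ▸ le_inf hwu (Finset.le_sup (f := id) hw)⟩

/-- Exponents above `m i` do not matter for membership in `I`, so lowering coordinate `i` from `b i
> m i` by one stays in `I`. Hence `K^b I` is a cone with apex `i`. -/
theorem insert_mem_koszulFaces_of_lt {m : Fin n →₀ ℕ}
    (hm : ∀ u : Fin n →₀ ℕ, MvPolynomial.monomial u (1 : k) ∈ I →
      MvPolynomial.monomial (u ⊓ m) (1 : k) ∈ I) {b : Fin n →₀ ℕ} {i : Fin n} (hi : m i < b i)
    {τ : Finset (Fin n)} (hτ : τ ∈ koszulFaces I b) (hiτ : i ∉ τ) :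
    insert i τ ∈ koszulFaces I b := by
  obtain ⟨h1, h2⟩ := hτ
  refine ⟨fun l => ?_, monomial_mem_of_le (fun l => ?_) (hm _ h2)⟩
  · have := h1 l
    simp only [indicator_apply, Finset.mem_insert] at this ⊢
    rcases eq_or_ne l i with rfl | hl
    · simp; omega
    · simpa [hl] using this
  · simp only [indicator_apply, Finsupp.inf_apply, Finsupp.coe_tsub, Pi.sub_apply,
      Finset.mem_insert]
    rcases eq_or_ne l i with rfl | hl
    · simp [hiτ]; omega
    · simp [hl]

/-- If `K^b I` is a cone, its reduced homology vanishes. -/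
theorem subsingleton_homology {b : Fin n →₀ ℕ} {i : Fin n}
    (h : ∀ τ ∈ koszulFaces I b, i ∉ τ → insert i τ ∈ koszulFaces I b) (j : ℕ) :
    Subsingleton (homology I b j) := by
  refine subsingleton_of_forall_eq 0 fun y => ?_
  obtain ⟨z, rfl⟩ := Submodule.Quotient.mk_surjective _ y
  refine (Submodule.Quotient.mk_eq_zero _).2
    ⟨⟨addVertex i (inclusion I b z.1), addVertex_mem_supported h (inclusion_mem b z.1)⟩,
      addVertex_card z.2.1, inclusion_injective b ?_⟩
  have h1 : boundary (inclusion I b z.1) = 0 :=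
    congrArg (inclusion I b) (LinearMap.mem_ker.1 z.2.2)
  have h2 := boundary_addVertex i (inclusion I b z.1)
  rw [h1, map_zero, add_zero] at h2
  exact h2

instance (b : Fin n →₀ ℕ) : FiniteDimensional k (chains I b) :=
  inferInstanceAs (FiniteDimensional k (Finsupp.supported k k (koszulFaces I b)))

theorem finite_stage (hI : IsMonomialIdeal I) (i : ℕ) :
    Module.Finite (MvPolynomial (Fin n) k) (stage I i) := by
  classical
  obtain ⟨m, hm⟩ := hI.exists_bound
  rw [Module.finite_def]
  have htop : (⊤ : Submodule (MvPolynomial (Fin n) k) (stage I i)) = ⨆ b ∈ Finset.Iic m,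
      LinearMap.range (DirectSum.lof (MvPolynomial (Fin n) k) (Fin n →₀ ℕ)
        (fun b => MvPolynomial (Fin n) k ⊗[k] homology I b i) b) := by
    refine (eq_top_iff.2 fun y _ => ?_).symm
    induction y using DirectSum.induction_on with
    | zero => exact zero_mem _
    | add x y hx hy => exact add_mem (hx trivial) (hy trivial)
    | of b x =>
      by_cases hb : b ≤ m
      · exact Submodule.mem_iSup_of_mem b
          (Submodule.mem_iSup_of_mem (Finset.mem_Iic.2 hb) ⟨x, rfl⟩)
      · obtain ⟨l, hl⟩ : ∃ l, m l < b l := by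
          by_contra! h
          exact hb h
        have := subsingleton_homology (I := I)
          (fun τ hτ => insert_mem_koszulFaces_of_lt hm hl hτ) i
        rw [Subsingleton.elim x 0, map_zero]
        exact zero_mem _
  rw [htop]
  exact Submodule.fg_biSup _ _ fun b _ => Submodule.FG.of_finite

end Finiteness

/-! ### From the graded pieces to the resolution over `k[x]`. -/

section Assembly

variable {k : Type*} [Field k] {n : ℕ} {I : Ideal (MvPolynomial (Fin n) k)} {i : ℕ}

/-- The inclusion of the summand of index `b` of `stage I i`. -/
abbrev stageOf (I : Ideal (MvPolynomial (Fin n) k)) (i : ℕ) (b : Fin n →₀ ℕ) :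
    MvPolynomial (Fin n) k ⊗[k] homology I b i →ₗ[MvPolynomial (Fin n) k] stage I i :=
  DirectSum.lof (MvPolynomial (Fin n) k) (Fin n →₀ ℕ)
    (fun b => MvPolynomial (Fin n) k ⊗[k] homology I b i) b

/-- The coefficient of `x^u` in an element of `k[x] ⊗ H`. -/
def tensorCoeff {H : Type*} [AddCommGroup H] [Module k H] (u : Fin n →₀ ℕ) :
    MvPolynomial (Fin n) k ⊗[k] H →ₗ[k] H :=
  TensorProduct.lid k H ∘ₗ (MvPolynomial.lcoeff k u).rTensor H

theorem tensorCoeff_tmul {H : Type*} [AddCommGroup H] [Module k H] (u : Fin n →₀ ℕ)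
    (p : MvPolynomial (Fin n) k) (h : H) : tensorCoeff u (p ⊗ₜ[k] h) = p.coeff u • h :=
  rfl

/-- The homogeneous element of degree `c` with components `x^(c-b) ⊗ x b`. -/
def assemble (c : Fin n →₀ ℕ) (x : ∀ b, homology I b i) : stage I i :=
  ∑ b ∈ Finset.Iic c, stageOf I i b (MvPolynomial.monomial (c - b) (1 : k) ⊗ₜ[k] x b)

/-- The homogeneous component of degree `c`. -/
def homogeneousPart (c : Fin n →₀ ℕ) : stage I i →+ ∀ b, homology I b i where
  toFun y b := if b ≤ c then tensorCoeff (c - b) (y b) else 0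
  map_zero' := by
    funext b
    simp
  map_add' y z := by
    funext b
    rw [Pi.add_apply, DirectSum.add_apply, map_add]
    split_ifs <;> simp

theorem homogeneousPart_apply (c b : Fin n →₀ ℕ) (y : stage I i) :
    homogeneousPart c y b = if b ≤ c then tensorCoeff (c - b) (y b) else 0 :=
  rfl

theorem homogeneousPart_eq_zero (c : Fin n →₀ ℕ) (y : stage I i) (b : Fin n →₀ ℕ) (hb : ¬ b ≤ c) :
    homogeneousPart c y b = 0 :=
  if_neg hb

theorem assemble_zero (c : Fin n →₀ ℕ) : assemble c (0 : ∀ b, homology I b i) = 0 :=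
  Finset.sum_eq_zero fun b _ => by rw [Pi.zero_apply, TensorProduct.tmul_zero, map_zero]

theorem homogeneousPart_stageOf (c b u : Fin n →₀ ℕ) (h : homology I b i) :
    homogeneousPart c (stageOf I i b (MvPolynomial.monomial u (1 : k) ⊗ₜ[k] h)) =
      if b + u = c then Pi.single b h else 0 := by
  classical
  funext b'
  rw [homogeneousPart_apply]
  rcases eq_or_ne b' b with rfl | hb
  · rw [stageOf, DirectSum.lof_eq_of, DirectSum.of_eq_same, tensorCoeff_tmul,
      MvPolynomial.coeff_monomial]
    by_cases hc : b' + u = c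
    · subst hc
      simp
    · rw [if_neg hc]
      split_ifs with h1 h2
      · exact absurd (by rw [h2, add_tsub_cancel_of_le h1]) hc
      · simp
      · rfl
  · rw [stageOf, DirectSum.lof_eq_of, DirectSum.of_eq_of_ne _ _ _ hb, map_zero, ite_self]
    split_ifs
    · rw [Pi.single_eq_of_ne hb]
    · rfl

theorem homogeneousPart_assemble (c c' : Fin n →₀ ℕ) (x : ∀ b, homology I b i)
    (hx : ∀ b, ¬ b ≤ c → x b = 0) :
    homogeneousPart c' (assemble c x) = if c = c' then x else 0 := by
  classical
  have h1 : ∀ b ∈ Finset.Iic c, homogeneousPart c' (stageOf I i b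
      (MvPolynomial.monomial (c - b) (1 : k) ⊗ₜ[k] x b)) =
      if c = c' then Pi.single b (x b) else 0 := fun b hb => by
    rw [homogeneousPart_stageOf, add_tsub_cancel_of_le (Finset.mem_Iic.1 hb)]
  rw [assemble, map_sum, Finset.sum_congr rfl h1]
  split_ifs
  · funext b
    rw [Finset.sum_apply, Finset.sum_pi_single]
    split_ifs with hb
    · rfl
    · rw [hx b fun h => hb (Finset.mem_Iic.2 h)]
  · simp

theorem assemble_single (b u : Fin n →₀ ℕ) (h : homology I b i) :
    assemble (b + u) (Pi.single b h) =
      stageOf I i b (MvPolynomial.monomial u (1 : k) ⊗ₜ[k] h) := by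
  classical
  rw [assemble, Finset.sum_eq_single b]
  · rw [Pi.single_eq_same, add_tsub_cancel_left]
  · intro b' _ hb'
    rw [Pi.single_eq_of_ne hb', TensorProduct.tmul_zero, map_zero]
  · intro hb
    simp at hb

theorem assemble_add (c : Fin n →₀ ℕ) (x y : ∀ b, homology I b i) :
    assemble c (x + y) = assemble c x + assemble c y := by
  simp only [assemble, Pi.add_apply, TensorProduct.tmul_add, map_add, Finset.sum_add_distrib]

@[elab_as_elim]
theorem stage_induction {motive : stage I i → Prop} (zero : motive 0)
    (of : ∀ (b u : Fin n →₀ ℕ) (h : homology I b i),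
      motive (stageOf I i b (MvPolynomial.monomial u (1 : k) ⊗ₜ[k] h)))
    (add : ∀ y z, motive y → motive z → motive (y + z)) (y : stage I i) : motive y := by
  classical
  induction y using DirectSum.induction_on with
  | zero => exact zero
  | add y z hy hz => exact add y z hy hz
  | of b x =>
    induction x using TensorProduct.induction_on with
    | zero => rw [map_zero]; exact zero
    | add x y hx hy => rw [map_add]; exact add _ _ hx hy
    | tmul p h =>
      induction p using MvPolynomial.induction_on' with
      | monomial u r =>
        have : MvPolynomial.monomial u r = r • MvPolynomial.monomial u (1 : k) := by
          rw [MvPolynomial.smul_monomial, smul_eq_mul, mul_one]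
        rw [this, TensorProduct.smul_tmul]
        exact of b u _
      | add p q hp hq => rw [TensorProduct.add_tmul, map_add]; exact add _ _ hp hq

/-- Allowing every finite set that contains `C₀` makes the additive case work: two elements can
share the union of their sets. -/
theorem exists_eq_sum_assemble (y : stage I i) : ∃ C₀ : Finset (Fin n →₀ ℕ), ∀ C, C₀ ⊆ C →
    y = ∑ c ∈ C, assemble c (homogeneousPart c y) := by
  classical
  induction y using stage_induction with
  | zero => exact ⟨∅, fun C _ => by simp [assemble_zero]⟩
  | of b u h =>
    refine ⟨{b + u}, fun C hC => ?_⟩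
    rw [Finset.sum_eq_single (b + u)]
    · rw [homogeneousPart_stageOf, if_pos rfl, assemble_single]
    · intro c _ hc
      rw [homogeneousPart_stageOf, if_neg hc.symm, assemble_zero]
    · intro hc
      exact absurd (hC (Finset.mem_singleton_self _)) hc
  | add y z hy hz =>
    obtain ⟨C₁, h₁⟩ := hy
    obtain ⟨C₂, h₂⟩ := hz
    refine ⟨C₁ ∪ C₂, fun C hC => ?_⟩
    simp only [map_add, assemble_add, Finset.sum_add_distrib]
    rw [← h₁ C (Finset.union_subset_left hC), ← h₂ C (Finset.union_subset_right hC)]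

theorem homogeneousPart_sum_assemble (C : Finset (Fin n →₀ ℕ))
    (x : (Fin n →₀ ℕ) → ∀ b, homology I b i) (hx : ∀ c b, ¬ b ≤ c → x c b = 0) {c : Fin n →₀ ℕ}
    (hc : c ∈ C) : homogeneousPart c (∑ c ∈ C, assemble c (x c)) = x c := by
  rw [map_sum, Finset.sum_eq_single c]
  · rw [homogeneousPart_assemble _ _ _ (hx c), if_pos rfl]
  · intro c' _ hc'
    rw [homogeneousPart_assemble _ _ _ (hx c'), if_neg hc']
  · exact fun h => absurd hc h

theorem inducedMap_tmul {H H' : Type*} [AddCommGroup H] [Module k H] [AddCommGroup H'] [Module k H']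
    (a b : Fin n →₀ ℕ) (f : H →ₗ[k] H') (p : MvPolynomial (Fin n) k) (h : H) :
    inducedMap a b f (p ⊗ₜ[k] h) = (MvPolynomial.monomial (b - a) (1 : k) * p) ⊗ₜ[k] f h :=
  rfl

theorem inducedMap_zero {H H' : Type*} [AddCommGroup H] [Module k H] [AddCommGroup H'] [Module k H']
    (a b : Fin n →₀ ℕ) : inducedMap a b (0 : H →ₗ[k] H') = 0 := by
  rw [inducedMap, LinearMap.baseChange_zero, smul_zero]

/-- The differential of the resolution. -/
def resolutionDiff (s : ∀ b, Splitting I b) (i : ℕ) :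
    stage I (i + 1) →ₗ[MvPolynomial (Fin n) k] stage I i :=
  DirectSum.toModule _ _ _ fun b =>
    ∑ a ∈ Finset.Iic b, stageOf I i a ∘ₗ inducedMap a b (homologyMap s a b i)

theorem resolutionDiff_stageOf (s : ∀ b, Splitting I b) (b : Fin n →₀ ℕ)
    (x : MvPolynomial (Fin n) k ⊗[k] homology I b (i + 1)) :
    resolutionDiff s i (stageOf I (i + 1) b x) =
      ∑ a ∈ Finset.Iic b, stageOf I i a (inducedMap a b (homologyMap s a b i) x) := by
  rw [resolutionDiff, stageOf, DirectSum.toModule_lof, LinearMap.sum_apply]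
  rfl

theorem component_resolutionDiff (s : ∀ b, Splitting I b) (a b : Fin n →₀ ℕ) :
    DirectSum.component (MvPolynomial (Fin n) k) _ _ a ∘ₗ resolutionDiff s i ∘ₗ
      stageOf I (i + 1) b = inducedMap a b (homologyMap s a b i) := by
  classical
  refine LinearMap.ext fun x => ?_
  rw [LinearMap.comp_apply, LinearMap.comp_apply, resolutionDiff_stageOf, map_sum]
  by_cases hab : a ≤ b
  · rw [Finset.sum_eq_single a]
    · rw [stageOf, DirectSum.component.of, dif_pos rfl]
    · intro a' _ ha'
      rw [stageOf, DirectSum.component.of, dif_neg ha']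
    · exact fun h => absurd (Finset.mem_Iic.2 hab) h
  · rw [homologyMap_eq_zero s i fun h => hab h.le, inducedMap_zero]
    refine Finset.sum_eq_zero fun a' ha' => ?_
    rw [stageOf, DirectSum.component.of, dif_neg]
    rintro rfl
    exact hab (Finset.mem_Iic.1 ha')

/-- Enlarging the range of `a` from `a ≤ b` to `a ≤ c` adds only zero components, and makes the
range independent of `b`, so that the sums over `a` and `b` can be exchanged. -/
theorem resolutionDiff_stageOf_monomial (s : ∀ b, Splitting I b) {b c : Fin n →₀ ℕ} (hbc : b ≤ c)
    (h : homology I b (i + 1)) :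
    resolutionDiff s i (stageOf I (i + 1) b (MvPolynomial.monomial (c - b) (1 : k) ⊗ₜ[k] h)) =
      ∑ a ∈ Finset.Iic c, stageOf I i a
        (MvPolynomial.monomial (c - a) (1 : k) ⊗ₜ[k] homologyMap s a b i h) := by
  rw [resolutionDiff_stageOf]
  refine Finset.sum_subset_zero_on_sdiff (Finset.Iic_subset_Iic.2 hbc) ?_ ?_
  · intro a ha
    rw [Finset.mem_sdiff, Finset.mem_Iic, Finset.mem_Iic] at ha
    rw [homologyMap_eq_zero s i fun h => ha.2 h.le, LinearMap.zero_apply, TensorProduct.tmul_zero,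
      map_zero]
  · intro a ha
    rw [inducedMap_tmul, MvPolynomial.monomial_mul, one_mul, add_comm,
      tsub_add_tsub_cancel hbc (Finset.mem_Iic.1 ha)]

/-- Reduces exactness over `k[x]` to exactness of `degreeDiff` in each degree. -/
theorem resolutionDiff_assemble (s : ∀ b, Splitting I b) (c : Fin n →₀ ℕ)
    (x : ∀ b, homology I b (i + 1)) :
    resolutionDiff s i (assemble c x) = assemble c (degreeDiff s c i x) := by
  rw [assemble, assemble, map_sum, Finset.sum_congr rfl fun b hb =>
    resolutionDiff_stageOf_monomial s (Finset.mem_Iic.1 hb) (x b), Finset.sum_comm]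
  refine Finset.sum_congr rfl fun a _ => ?_
  rw [degreeDiff, TensorProduct.tmul_sum, map_sum]

theorem exact_resolutionDiff (s : ∀ b, Splitting I b) (i : ℕ) :
    Function.Exact (resolutionDiff s (i + 1)) (resolutionDiff s i) := by
  intro y
  constructor
  · intro hy
    obtain ⟨C, hC⟩ := exists_eq_sum_assemble y
    have hyC := hC C subset_rfl
    -- The image is a sum of homogeneous elements of distinct degrees, so each of them vanishes.
    have h0 (c) (hc : c ∈ C) : degreeDiff s c i (homogeneousPart c y) = 0 := by
      have h1 : ∑ c ∈ C, assemble c (degreeDiff s c i (homogeneousPart c y)) = 0 := by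
        rw [← hy]
        conv_rhs => rw [hyC, map_sum]
        exact Finset.sum_congr rfl fun c _ => (resolutionDiff_assemble s c _).symm
      rw [← homogeneousPart_sum_assemble C
        (fun c => degreeDiff s c i (homogeneousPart c y))
        (fun c => degreeDiff_eq_zero s i _) hc]
      rw [h1, map_zero]
    choose! z hz using fun c (hc : c ∈ C) =>
      exact_degreeDiff s (homogeneousPart c y) (homogeneousPart_eq_zero c y) (h0 c hc)
    refine ⟨∑ c ∈ C, assemble c (z c), ?_⟩
    rw [map_sum, hyC]
    refine Finset.sum_congr rfl fun c hc => ?_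
    rw [resolutionDiff_assemble, (hz c hc).2]
  · rintro ⟨z, rfl⟩
    obtain ⟨C, hC⟩ := exists_eq_sum_assemble z
    rw [hC C subset_rfl, map_sum, map_sum]
    refine Finset.sum_eq_zero fun c _ => ?_
    rw [resolutionDiff_assemble, resolutionDiff_assemble,
      degreeDiff_degreeDiff s _ (homogeneousPart_eq_zero c z), assemble_zero]

theorem resolutionDiff_mem_gradedPiece (s : ∀ b, Splitting I b) (c : Fin n →₀ ℕ)
    {y : stage I (i + 1)} (hy : y ∈ gradedPiece I (i + 1) c) :
    resolutionDiff s i y ∈ gradedPiece I i c := by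
  induction hy using Submodule.span_induction with
  | mem y hy =>
    obtain ⟨b, u, h, rfl, rfl⟩ := hy
    have := resolutionDiff_stageOf_monomial s (le_self_add : b ≤ b + u) h
    rw [add_tsub_cancel_left] at this
    rw [this]
    refine sum_mem fun a ha => Submodule.subset_span ⟨a, b + u - a, _, ?_, rfl⟩
    exact add_tsub_cancel_of_le (Finset.mem_Iic.1 ha)
  | zero => rw [map_zero]; exact zero_mem _
  | add x y _ _ hx hy => rw [map_add]; exact add_mem hx hy
  | smul r x _ hx =>
    rw [LinearMap.map_smul_of_tower]
    exact Submodule.smul_mem _ r hx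

theorem range_resolutionDiff_le (s : ∀ b, Splitting I b) (i : ℕ) :
    LinearMap.range (resolutionDiff s i) ≤ (Ideal.span (Set.range MvPolynomial.X) :
      Ideal (MvPolynomial (Fin n) k)) • (⊤ : Submodule (MvPolynomial (Fin n) k) (stage I i)) := by
  rintro _ ⟨y, rfl⟩
  induction y using DirectSum.induction_on with
  | zero => rw [map_zero]; exact zero_mem _
  | add y z hy hz => rw [map_add]; exact add_mem hy hz
  | of b x =>
    have := resolutionDiff_stageOf s b x
    rw [stageOf, DirectSum.lof_eq_of] at this
    rw [this]
    refine sum_mem fun a ha => ?_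
    -- There is no path from `b` to itself, so the diagonal component is zero; otherwise some
    -- variable divides `x^(b-a)`.
    rcases eq_or_lt_of_le (Finset.mem_Iic.1 ha) with rfl | hab
    · rw [homologyMap_eq_zero s i (lt_irrefl _), inducedMap_zero, LinearMap.zero_apply, map_zero]
      exact zero_mem _
    · rw [inducedMap, LinearMap.smul_apply, map_smul]
      refine Submodule.smul_mem_smul ?_ trivial
      obtain ⟨l, hl⟩ : ∃ l, (b - a) l ≠ 0 := by
        by_contra! h
        have : b - a = 0 := Finsupp.ext h
        exact hab.not_ge (tsub_eq_zero_iff_le.1 this)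
      have h1 : Finsupp.single l 1 ≤ b - a := Finsupp.single_le_iff.2 (Nat.one_le_iff_ne_zero.2 hl)
      rw [← tsub_add_cancel_of_le h1, ← one_mul (1 : k), ← MvPolynomial.monomial_mul]
      exact Ideal.mul_mem_left _ _ (Ideal.subset_span ⟨l, rfl⟩)

/-- The map `k[x] ⊗ H → k[x]`, `p ⊗ h ↦ x^b f(h) p`. -/
def monomialMap {H : Type*} [AddCommGroup H] [Module k H] (b : Fin n →₀ ℕ) (f : H →ₗ[k] k) :
    MvPolynomial (Fin n) k ⊗[k] H →ₗ[MvPolynomial (Fin n) k] MvPolynomial (Fin n) k :=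
  MvPolynomial.monomial b (1 : k) •
    ((TensorProduct.AlgebraTensorModule.rid k (MvPolynomial (Fin n) k)
      (MvPolynomial (Fin n) k)).toLinearMap ∘ₗ f.baseChange (MvPolynomial (Fin n) k))

theorem monomialMap_tmul {H : Type*} [AddCommGroup H] [Module k H] (b : Fin n →₀ ℕ)
    (f : H →ₗ[k] k) (p : MvPolynomial (Fin n) k) (h : H) :
    monomialMap b f (p ⊗ₜ[k] h) = MvPolynomial.monomial b (f h) * p := by
  have : monomialMap b f (p ⊗ₜ[k] h) = MvPolynomial.monomial b (1 : k) * (f h • p) := rfl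
  rw [this, mul_smul_comm, ← smul_mul_assoc, MvPolynomial.smul_monomial, smul_eq_mul, mul_one]

theorem monomial_homologyAugmentation_mem {b : Fin n →₀ ℕ} (s : Splitting I b)
    (h : homology I b 0) : MvPolynomial.monomial b (homologyAugmentation s h) ∈ I := by
  by_cases h0 : homologyAugmentation s h = 0
  · rw [h0, MvPolynomial.monomial_zero]
    exact zero_mem _
  · have h1 : ∅ ∈ koszulFaces I b :=
      ((Finsupp.mem_supported _ _).1 (inclusion_mem b (harmonicRep s 0 h)))
        (Finset.mem_coe.2 (Finsupp.mem_support_iff.2 h0))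
    have h2 : MvPolynomial.monomial b (1 : k) ∈ I := by simpa [indicator] using h1.2
    rw [← mul_one (homologyAugmentation s h), ← MvPolynomial.C_mul_monomial]
    exact I.mul_mem_left _ h2

/-- The augmentation of the resolution, with values in `k[x]`. -/
def resolutionAugmentationAux (s : ∀ b, Splitting I b) :
    stage I 0 →ₗ[MvPolynomial (Fin n) k] MvPolynomial (Fin n) k :=
  DirectSum.toModule _ _ _ fun b => monomialMap b (homologyAugmentation (s b))

theorem resolutionAugmentationAux_stageOf (s : ∀ b, Splitting I b) (b u : Fin n →₀ ℕ)
    (h : homology I b 0) :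
    resolutionAugmentationAux s (stageOf I 0 b (MvPolynomial.monomial u (1 : k) ⊗ₜ[k] h)) =
      MvPolynomial.monomial (b + u) (homologyAugmentation (s b) h) := by
  rw [resolutionAugmentationAux, stageOf, DirectSum.toModule_lof, monomialMap_tmul,
    MvPolynomial.monomial_mul, mul_one]

theorem resolutionAugmentationAux_mem (s : ∀ b, Splitting I b) (y : stage I 0) :
    resolutionAugmentationAux s y ∈ I := by
  induction y using stage_induction with
  | zero => rw [map_zero]; exact zero_mem _
  | add y z hy hz => rw [map_add]; exact add_mem hy hz
  | of b u h =>
    rw [resolutionAugmentationAux_stageOf, ← mul_one (homologyAugmentation (s b) h),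
      ← MvPolynomial.monomial_mul]
    exact I.mul_mem_right _ (monomial_homologyAugmentation_mem (s b) h)

/-- The augmentation of the resolution. -/
def resolutionAugmentation (s : ∀ b, Splitting I b) :
    stage I 0 →ₗ[MvPolynomial (Fin n) k] I :=
  (resolutionAugmentationAux s).codRestrict I (resolutionAugmentationAux_mem s)

theorem coe_resolutionAugmentation (s : ∀ b, Splitting I b) (y : stage I 0) :
    (resolutionAugmentation s y : MvPolynomial (Fin n) k) = resolutionAugmentationAux s y :=
  rfl

theorem resolutionAugmentationAux_assemble (s : ∀ b, Splitting I b) (c : Fin n →₀ ℕ)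
    (x : ∀ b, homology I b 0) :
    resolutionAugmentationAux s (assemble c x) = MvPolynomial.monomial c
      (∑ b ∈ Finset.Iic c, homologyAugmentation (s b) (x b)) := by
  rw [assemble, map_sum, map_sum]
  refine Finset.sum_congr rfl fun b hb => ?_
  rw [resolutionAugmentationAux_stageOf, add_tsub_cancel_of_le (Finset.mem_Iic.1 hb)]

theorem exact_resolutionAugmentation (s : ∀ b, Splitting I b) :
    Function.Exact (resolutionDiff s 0) (resolutionAugmentation s) := by
  classical
  intro y
  rw [Subtype.ext_iff, coe_resolutionAugmentation, ZeroMemClass.coe_zero]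
  constructor
  · intro hy
    obtain ⟨C, hC⟩ := exists_eq_sum_assemble y
    have hyC := hC C subset_rfl
    have h0 (c) (hc : c ∈ C) :
        ∑ b ∈ Finset.Iic c, homologyAugmentation (s b) (homogeneousPart c y b) = 0 := by
      have h1 : resolutionAugmentationAux s y = ∑ c ∈ C, MvPolynomial.monomial c
          (∑ b ∈ Finset.Iic c, homologyAugmentation (s b) (homogeneousPart c y b)) := by
        conv_lhs => rw [hyC, map_sum]
        exact Finset.sum_congr rfl fun c _ => resolutionAugmentationAux_assemble s c _
      rw [hy] at h1
      have h2 := congrArg (MvPolynomial.coeff c) h1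
      rw [MvPolynomial.coeff_zero, MvPolynomial.coeff_sum] at h2
      simp only [MvPolynomial.coeff_monomial] at h2
      rw [Finset.sum_ite_eq' C c, if_pos hc] at h2
      exact h2.symm
    choose! z hz using fun c (hc : c ∈ C) =>
      exact_homologyAugmentation s (homogeneousPart c y) (homogeneousPart_eq_zero c y) (h0 c hc)
    refine ⟨∑ c ∈ C, assemble c (z c), ?_⟩
    rw [map_sum, hyC]
    refine Finset.sum_congr rfl fun c hc => ?_
    rw [resolutionDiff_assemble, (hz c hc).2]
  · rintro ⟨z, rfl⟩
    obtain ⟨C, hC⟩ := exists_eq_sum_assemble z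
    rw [hC C subset_rfl, map_sum, map_sum]
    refine Finset.sum_eq_zero fun c _ => ?_
    rw [resolutionDiff_assemble, resolutionAugmentationAux_assemble,
      sum_homologyAugmentation_degreeDiff s _ (homogeneousPart_eq_zero c z),
      MvPolynomial.monomial_zero]

theorem surjective_resolutionAugmentation (hI : IsMonomialIdeal I) (s : ∀ b, Splitting I b) :
    Function.Surjective (resolutionAugmentation s) := by
  have h : I ≤ LinearMap.range (resolutionAugmentationAux s) := by
    obtain ⟨S, hS⟩ := hI
    have h1 : Ideal.span ((fun u => MvPolynomial.monomial u (1 : k)) '' S) ≤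
        LinearMap.range (resolutionAugmentationAux s) := by
      refine Submodule.span_le.2 ?_
      rintro _ ⟨c, hc, rfl⟩
      have hcI : MvPolynomial.monomial c (1 : k) ∈ I := by
        rw [hS]
        exact Ideal.subset_span ⟨c, hc, rfl⟩
      -- Each monomial generator `x^c` is reached by a homogeneous element of degree `c`.
      obtain ⟨x, -, hx1⟩ := exists_sum_homologyAugmentation_eq_one s hcI
      exact ⟨assemble c x, by rw [resolutionAugmentationAux_assemble, hx1]⟩
    exact hS.le.trans h1
  rintro ⟨p, hp⟩
  obtain ⟨y, hy⟩ := h hp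
  exact ⟨y, Subtype.ext hy⟩

theorem exists_resolutionAugmentationAux_eq_monomial (s : ∀ b, Splitting I b) (c : Fin n →₀ ℕ)
    {y : stage I 0} (hy : y ∈ gradedPiece I 0 c) :
    ∃ r : k, resolutionAugmentationAux s y = MvPolynomial.monomial c r := by
  induction hy using Submodule.span_induction with
  | mem y hy =>
    obtain ⟨b, u, h, rfl, rfl⟩ := hy
    exact ⟨_, resolutionAugmentationAux_stageOf s b u h⟩
  | zero => exact ⟨0, by simp⟩
  | add x y _ _ hx hy =>
    obtain ⟨r, hr⟩ := hx
    obtain ⟨t, ht⟩ := hy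
    exact ⟨r + t, by rw [map_add, hr, ht, map_add]⟩
  | smul r x _ hx =>
    obtain ⟨t, ht⟩ := hx
    exact ⟨r * t, by
      rw [LinearMap.map_smul_of_tower, ht, MvPolynomial.smul_monomial, smul_eq_mul]⟩

theorem isMinimalFreeResolution (hI : IsMonomialIdeal I) (s : ∀ b, Splitting I b) :
    IsMinimalFreeResolution (Ideal.span (Set.range MvPolynomial.X)) (stage I) (resolutionDiff s)
      (resolutionAugmentation s) where
  free _ := inferInstance
  finite i := finite_stage hI i
  exact i := exact_resolutionDiff s i
  exact_augmentation := exact_resolutionAugmentation s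
  surjective := surjective_resolutionAugmentation hI s
  minimal i := range_resolutionDiff_le s i

end Assembly

end KoszulSplit

end

theorem theorem7p1 {k : Type*} [Field k] {n : ℕ} (I : Ideal (MvPolynomial (Fin n) k))
    (hI : KoszulSplit.IsMonomialIdeal I) (s : ∀ b : Fin n →₀ ℕ, KoszulSplit.Splitting I b) :
    ∃ (D : ∀ i, KoszulSplit.stage I (i + 1) →ₗ[MvPolynomial (Fin n) k] KoszulSplit.stage I i)
      (ε : KoszulSplit.stage I 0 →ₗ[MvPolynomial (Fin n) k] I),
      -- the component of `D i` from the summand of index `b` to the summand of index `a`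
      (∀ (i : ℕ) (a b : Fin n →₀ ℕ),
        DirectSum.component (MvPolynomial (Fin n) k) _ _ a ∘ₗ D i ∘ₗ
            DirectSum.lof (MvPolynomial (Fin n) k) _ _ b =
          KoszulSplit.inducedMap a b (KoszulSplit.homologyMap s a b i)) ∧
      KoszulSplit.IsMinimalFreeResolution (Ideal.span (Set.range MvPolynomial.X))
        (KoszulSplit.stage I) D ε ∧
      -- the resolution is graded by `ℕ^n`
      (∀ (i : ℕ) (c : Fin n →₀ ℕ), ∀ y ∈ KoszulSplit.gradedPiece I (i + 1) c,
        D i y ∈ KoszulSplit.gradedPiece I i c) ∧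
      (∀ (c : Fin n →₀ ℕ), ∀ y ∈ KoszulSplit.gradedPiece I 0 c,
        ∃ r : k, (ε y : MvPolynomial (Fin n) k) = MvPolynomial.monomial c r) :=
  ⟨KoszulSplit.resolutionDiff s, KoszulSplit.resolutionAugmentation s,
    fun _ a b => KoszulSplit.component_resolutionDiff s a b,
    KoszulSplit.isMinimalFreeResolution hI s,
    fun _ c _ hy => KoszulSplit.resolutionDiff_mem_gradedPiece s c hy,
    fun c _ hy => KoszulSplit.exists_resolutionAugmentationAux_eq_monomial s c hy⟩
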